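/- **Model.** Risk types lie in $\Theta=[\underline\theta,\bar\theta]$ with $\underline\theta<\bar\theta$, and have a continuous density $f:\Theta\to(0,\infty)$ and distribution function $F$. Valuations lie in $B=[0,\bar b)$ with $0<\bar b\le\infty$. Type $\theta$ draws her valuation from the distribution function $H_\theta$ on $B$ (with $H_\theta=1$ on $[\bar b,\infty)$ if $\bar b<\infty$), where: - $H_\theta$ increases in $\theta$ in first-order stochastic dominance; - $H_\theta(b)$ is $C^1$ in $\theta\in\Theta$ for each $b\in B$, and $C^1$ in $b\in B$ with derivative $h_\theta(b)>0$ for each $\theta$ (with $h_\theta=0$ above $\bar b$); - $\partial^2H_\theta(b)/\partial b\,\partial\theta$ exists and is continuous on $\Theta\times B$. The distortion $g:[0,1]\to[0,1]$ is non-decreasing and $C^1$, with $g(q)\le q$, $g(0)=0$, $g(1)=1$. The supply $S:[0,\infty)\to[0,\infty)$ is strictly increasing, $C^1$ and unbounded, with $S(0)=0$. Let $\beta\ge0$. Let $p^N>0$ and $p^F>0$ satisfy $$S(p^N)=\int_\Theta[1-H_\theta(p^N)]f(\theta)\,d\theta,\qquad S(p^F)=\int_\Theta[1-H_\theta(0)]f(\theta)\,d\theta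 .$$ For a price $p$ put $$RS(p)=S(p)-\int_\Theta[1-H_\theta(p)]f(\theta)\,d\theta,$$ $$J(\theta,b)=\Bigl[1-g(H_\theta(b))+\tfrac{1-F(\theta)}{f(\theta)}\,g'(H_\theta(b))\,\tfrac{\partial H_\theta(b)}{\partial\theta}\Bigr]\tfrac1{h_\theta(b)}+b-p-\tfrac{1-H_\theta(b)}{h_\theta(b)},$$ $$K(p)=\int_0^{\beta+p}[1-g(H_{\underline\theta}(b))]\,db-\int_0^p[1-g(H_{\underline\theta}(b))]\,db .$$ **The relaxed first-stage problem at $p$.** Maximize $$\int_\Theta\int_0^p x(\theta,b)J(\theta,b)h_\theta(b)\,db\,f(\theta)\,d\theta+K(p)$$ over measurable $x:\Theta\times B\to[0,1]$ such that $x(\theta,\cdot)$ is non-decreasing for every $\theta$ and $$\int_\Theta\int_0^p x(\theta,b)h_\theta(b)\,db\,f(\theta)\,d\theta=RS(p).$$ **Contracts.** A contract is a set of items $(x,D)$, each covering $x$ units of service at a per-unit out-of-pocket cost $D$. With $b_p=\min\{b,p\}$, an agent with valuation $b$ who engages with $(x,D)$ has loss $x\min\{D,b_p\}+(1-x)b_p$;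 making no use of the insurance costs $b_p$. Type $\theta$ *receives* a contract under $x$ if the following hold: - for every $b\in B$ with $b\le p$, $x(\theta,b)$ is the smallest coverage among the loss-minimizing options (the items of the contract, or no use of the insurance, which is coverage $0$); - for every $b\in B$ with $b>p$, $x(\theta,b)=1$ and an item with coverage $1$ is loss-minimizing. **Theorem.** For every $p\in[p^N,p^F]$ there are a number $\alpha\in(0,1)$, common to all risk types, and a solution $x$ of the relaxed first-stage problem at $p$, such that every risk type $\theta\in\Theta$ receives under $x$ one of the following: - a simple deductible contract $\{(1,D(\theta))\}$ with $D(\theta)\in[0,p]$; - a limited-coverage deductible contract $\{(\alpha,D(\theta)),(1,M(\theta))\}$ with $0\le D(\theta)<M(\theta)\le p$. -/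

import Mathlib

open MeasureTheory Set

noncomputable section

/-- The primitives of the insurance model and the standing assumptions on them.  A function of a
risk type or of a valuation is a total function on `ℝ`; only its values on the stated domain are
constrained. -/
structure InsuranceModel where
  /-- the lowest risk type -/
  θlo : ℝ
  /-- the highest risk type -/
  θhi : ℝ
  /-- the (possibly infinite) upper end of the set of valuations -/
  bbar : EReal
  /-- the density of the risk types -/
  f : ℝ → ℝ
  /-- `H θ` is the distribution function of the valuation of an agent with risk type `θ` -/
  H : ℝ → ℝ → ℝ
  /-- the probability distortion function of the dual utility -/
  g : ℝ → ℝ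
  /-- the supply function of services -/
  S : ℝ → ℝ
  /-- the surcharge on the service price that an uninsured agent faces -/
  β : ℝ
  θlo_lt_θhi : θlo < θhi
  bbar_pos : 0 < bbar
  f_continuousOn : ContinuousOn f (Icc θlo θhi)
  f_pos : ∀ θ ∈ Icc θlo θhi, 0 < f θ
  f_integral : ∫ θ in θlo..θhi, f θ = 1
  H_mem : ∀ θ ∈ Icc θlo θhi, ∀ b : ℝ, 0 ≤ b → (b : EReal) < bbar → H θ b ∈ Icc (0 : ℝ) 1
  H_isLUB : ∀ θ ∈ Icc θlo θhi, IsLUB (H θ '' {b : ℝ | 0 ≤ b ∧ (b : EReal) < bbar}) 1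
  /-- a distribution function equals one above the support -/
  H_eq_one : ∀ θ ∈ Icc θlo θhi, ∀ b : ℝ, bbar ≤ (b : EReal) → H θ b = 1
  /-- first-order stochastic dominance -/
  H_fosd : ∀ b : ℝ, 0 ≤ b → (b : EReal) < bbar → AntitoneOn (fun θ => H θ b) (Icc θlo θhi)
  H_contDiffOn_type : ∀ b : ℝ, 0 ≤ b → (b : EReal) < bbar →
    ContDiffOn ℝ 1 (fun θ => H θ b) (Icc θlo θhi)
  H_contDiffOn_valuation : ∀ θ ∈ Icc θlo θhi,
    ContDiffOn ℝ 1 (H θ) {b : ℝ | 0 ≤ b ∧ (b : EReal) < bbar}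
  H_density_pos : ∀ θ ∈ Icc θlo θhi, ∀ b : ℝ, 0 ≤ b → (b : EReal) < bbar →
    0 < derivWithin (H θ) {b : ℝ | 0 ≤ b ∧ (b : EReal) < bbar} b
  /-- the cross partial derivative `∂²H/∂b∂θ` exists -/
  H_cross_exists : ∀ θ ∈ Icc θlo θhi,
    DifferentiableOn ℝ (fun b => derivWithin (fun t => H t b) (Icc θlo θhi) θ)
      {b : ℝ | 0 ≤ b ∧ (b : EReal) < bbar}
  /-- the cross partial derivative `∂²H/∂b∂θ` is continuous -/
  H_cross_continuousOn :
    ContinuousOn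
      (fun z : ℝ × ℝ =>
        derivWithin (fun b => derivWithin (fun t => H t b) (Icc θlo θhi) z.1)
          {b : ℝ | 0 ≤ b ∧ (b : EReal) < bbar} z.2)
      (Icc θlo θhi ×ˢ {b : ℝ | 0 ≤ b ∧ (b : EReal) < bbar})
  g_mem : ∀ q ∈ Icc (0 : ℝ) 1, g q ∈ Icc (0 : ℝ) 1
  g_monotoneOn : MonotoneOn g (Icc 0 1)
  g_contDiffOn : ContDiffOn ℝ 1 g (Icc 0 1)
  g_le : ∀ q ∈ Icc (0 : ℝ) 1, g q ≤ q
  g_zero : g 0 = 0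
  g_one : g 1 = 1
  S_strictMonoOn : StrictMonoOn S (Ici 0)
  S_contDiffOn : ContDiffOn ℝ 1 S (Ici 0)
  S_unbounded : ¬ BddAbove (S '' Ici 0)
  S_zero : S 0 = 0
  β_nonneg : 0 ≤ β

namespace InsuranceModel

variable (E : InsuranceModel)

/-- The set `Θ` of risk types. -/
def Θ : Set ℝ := Icc E.θlo E.θhi

/-- The set `B = [0, b̄)` of valuations. -/
def B : Set ℝ := {b : ℝ | 0 ≤ b ∧ (b : EReal) < E.bbar}

/-- The distribution function of the risk types. -/
def F (θ : ℝ) : ℝ := ∫ t in E.θlo..θ, E.f t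

/-- The density of the valuations of risk type `θ`; it vanishes above `b̄`. -/
def h (θ b : ℝ) : ℝ := derivWithin (E.H θ) E.B b

/-- The partial derivative of `H` in the risk type. -/
def dH (θ b : ℝ) : ℝ := derivWithin (fun t => E.H t b) E.Θ θ

/-- The derivative of the distortion function. -/
def dg (q : ℝ) : ℝ := derivWithin E.g (Icc 0 1) q

/-- Demand at price `p` of the agents with a valuation above `p`; this is the whole demand when
no coverage is provided. -/
def uncoveredDemand (p : ℝ) : ℝ := ∫ θ in E.θlo..E.θhi, (1 - E.H θ p) * E.f θ

/-- Demand under full coverage. -/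
def fullDemand : ℝ := ∫ θ in E.θlo..E.θhi, (1 - E.H θ 0) * E.f θ

/-- `p` is a price that clears the service market in the absence of coverage. -/
def IsNoCoveragePrice (p : ℝ) : Prop := 0 < p ∧ E.S p = E.uncoveredDemand p

/-- `p` is a price that clears the service market under full coverage. -/
def IsFullCoveragePrice (p : ℝ) : Prop := 0 < p ∧ E.S p = E.fullDemand

/-- The residual supply of services at price `p`. -/
def RS (p : ℝ) : ℝ := E.S p - E.uncoveredDemand p

/-- The sum of the virtual values of the two periods at price `p`. -/
def J (p θ b : ℝ) : ℝ :=
  (1 - E.g (E.H θ b) + (1 - E.F θ) / E.f θ * E.dg (E.H θ b) * E.dH θ b) * (1 / E.h θ b)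
    + (b - p - (1 - E.H θ b) / E.h θ b)

/-- The payoff of risk type `θ` when she is uninsured. -/
def UNP (p θ : ℝ) : ℝ := -∫ b in (0 : ℝ)..(E.β + p), (1 - E.g (E.H θ b))

/-- The part of the profits that does not depend on the allocation. -/
def K (p : ℝ) : ℝ :=
  -E.UNP p E.θlo - ∫ b in (0 : ℝ)..p, (1 - E.g (E.H E.θlo b))

/-- The profits from the allocation `x` at price `p`. -/
def profit (p : ℝ) (x : ℝ → ℝ → ℝ) : ℝ :=
  (∫ θ in E.θlo..E.θhi,
    (∫ b in (0 : ℝ)..p, x θ b * E.J p θ b * E.h θ b) * E.f θ) + E.K p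

/-- The demand generated by the allocation `x` among valuations up to `p`. -/
def coveredDemand (p : ℝ) (x : ℝ → ℝ → ℝ) : ℝ :=
  ∫ θ in E.θlo..E.θhi, (∫ b in (0 : ℝ)..p, x θ b * E.h θ b) * E.f θ

/-- The feasible allocations of the relaxed first-stage problem at price `p`: functions on
`Θ × B` with values in `[0, 1]`, Lebesgue measurable, non-decreasing in the valuation, that
satisfy the equilibrium constraint. -/
structure IsFeasible (p : ℝ) (x : ℝ → ℝ → ℝ) : Prop where
  aemeasurable : AEMeasurable (fun z : ℝ × ℝ => x z.1 z.2) (volume.restrict (E.Θ ×ˢ E.B))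
  mem_unit : ∀ θ ∈ E.Θ, ∀ b ∈ E.B, x θ b ∈ Icc (0 : ℝ) 1
  mono : ∀ θ ∈ E.Θ, MonotoneOn (x θ) E.B
  eq : E.coveredDemand p x = E.RS p

/-- The allocation `x` solves the relaxed first-stage problem at price `p`. -/
def IsSolution (p : ℝ) (x : ℝ → ℝ → ℝ) : Prop :=
  E.IsFeasible p x ∧ ∀ y, E.IsFeasible p y → E.profit p y ≤ E.profit p x

/-- The loss, at service price `p`, of an agent with valuation `b` who engages with the contract
item `c = (x, D)`: it covers `x` units of service at a per-unit out-of-pocket cost of `D`. -/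
def itemLoss (p b : ℝ) (c : ℝ × ℝ) : ℝ :=
  c.1 * min c.2 (min b p) + (1 - c.1) * min b p

/-- The coverages of the loss-minimizing options of an agent with valuation `b` who holds the
contract `C`.  The option `(0, 0)` stands for making no use of the insurance. -/
def optimalCoverages (p : ℝ) (C : Set (ℝ × ℝ)) (b : ℝ) : Set ℝ :=
  Prod.fst '' {c | c ∈ insert (0, 0) C ∧ ∀ c' ∈ insert (0, 0) C, itemLoss p b c ≤ itemLoss p b c'}

/-- `ξ` is the allocation, as a function of the valuation, that results from the contract `C` at
service price `p`.  A valuation up to `p` makes an optimal choice, and takes the smallest coverage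
when she is indifferent.  A valuation above `p` consumes the full unit, and an item of the
contract that covers the full unit is an optimal choice for her. -/
def Induces (p : ℝ) (C : Set (ℝ × ℝ)) (ξ : ℝ → ℝ) : Prop :=
  ∀ b ∈ E.B, (b ≤ p → IsLeast (optimalCoverages p C b) (ξ b)) ∧
    (p < b → ξ b = 1 ∧ 1 ∈ optimalCoverages p C b)

end InsuranceModel

end

/-! For a fixed price the problem is linear in the allocation, with monotonicity in the valuation
for each type and a single linear constraint linking the types. Charge covered demand at a rate `r`.
For one type, a monotone allocation is an average of indicators of upper intervals, so the charged
objective is maximized by full coverage above some threshold (`setIntegral_monotoneOn_mul_le`).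

The smallest optimal threshold increases with `r`, so total covered demand decreases with `r`. At
the critical rate this demand may jump across the required level. The left and right limits of the
thresholds, `D₁ ≤ D₂`, are then both optimal for every type at the critical rate, and their total
demands enclose the required level (`exists_threshold_pair`). Mixing the two threshold policies with
one weight `α` meets the constraint exactly and stays optimal type by type, so weak duality makes it
optimal (`integral_mul_le_of_isMaxOn`). The weight is common to all types because only one aggregate
constraint has to be met.

The mixture gives coverage `0` up to `D₁`, `α` up to `D₂` and `1` above. It is a simple deductible
if `D₁ = D₂`; otherwise it is a limited-coverage contract with out-of-pocket maximum `α * D₁ + (1 -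
α) * D₂` (`induces_limited`).

What remains is to show that the model fits this scheme: the residual supply lies between zero and
the coverable demand (`RS_nonneg`, `RS_le`), and the weighted virtual value is integrable
(`integrable_J_mul_h_mul_f`). -/

noncomputable section

open Filter Topology

/-! ### Smallest maximizers and their measurability -/

/-- The smallest maximizer of `γ` on `[0, c]`. -/
def leastArgmax (c : ℝ) (γ : ℝ → ℝ) : ℝ := sInf {D | D ∈ Icc 0 c ∧ IsMaxOn γ (Icc 0 c) D}

theorem isLeast_leastArgmax {c : ℝ} (hc : 0 ≤ c) {γ : ℝ → ℝ} (hγ : ContinuousOn γ (Icc 0 c)) :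
    IsLeast {D | D ∈ Icc 0 c ∧ IsMaxOn γ (Icc 0 c) D} (leastArgmax c γ) := by
  obtain ⟨D₀, hD₀, hmax⟩ := isCompact_Icc.exists_isMaxOn (nonempty_Icc.2 hc) hγ
  have hset : {D | D ∈ Icc 0 c ∧ IsMaxOn γ (Icc 0 c) D} = Icc 0 c ∩ γ ⁻¹' Ici (γ D₀) := by
    ext D
    simp only [mem_ofPred_eq, mem_inter_iff, mem_preimage, mem_Ici, and_congr_right_iff]
    intro _
    exact ⟨fun h => h hD₀, fun h D' hD' => (hmax hD').trans h⟩
  refine IsCompact.isLeast_sInf ?_ ⟨D₀, hD₀, hmax⟩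
  rw [hset]
  exact isCompact_Icc.of_isClosed_subset
    (hγ.preimage_isClosed_of_isClosed isClosed_Icc isClosed_Ici) inter_subset_left

/-- The smallest maximizer is at most `t` exactly when the maximum over `[0, t]` reaches the maximum
over `[0, c]`. By continuity this can be tested on countable dense sets, up to errors `1 / (n + 1)`.
-/
theorem measurable_leastArgmax {Ω : Type*} [MeasurableSpace Ω] {c : ℝ} (hc : 0 ≤ c)
    {Γ : Ω → ℝ → ℝ} (hcont : ∀ ω, ContinuousOn (Γ ω) (Icc 0 c))
    (hmeas : ∀ D ∈ Icc 0 c, Measurable fun ω => Γ ω D) :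
    Measurable fun ω => leastArgmax c (Γ ω) := by
  refine measurable_of_Iic fun t => ?_
  have hspec := fun ω => isLeast_leastArgmax hc (hcont ω)
  rcases lt_or_ge t 0 with ht | ht
  · convert MeasurableSet.empty
    ext ω
    simp only [mem_preimage, mem_Iic, mem_empty_iff_false, iff_false, not_le]
    exact ht.trans_le (hspec ω).1.1.1
  rcases lt_or_ge c t with htc | htc
  · convert MeasurableSet.univ
    ext ω
    simp only [mem_preimage, mem_Iic, mem_univ, iff_true]
    exact (hspec ω).1.1.2.trans htc.le
  have : Nonempty (Icc 0 t) := ⟨⟨0, by simp [ht]⟩⟩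
  have : Nonempty (Icc 0 c) := ⟨⟨0, by simp [hc]⟩⟩
  let u : ℕ → Icc 0 t := TopologicalSpace.denseSeq _
  let v : ℕ → Icc 0 c := TopologicalSpace.denseSeq _
  have hu : DenseRange u := TopologicalSpace.denseRange_denseSeq _
  have hv : DenseRange v := TopologicalSpace.denseRange_denseSeq _
  have hsub : Icc 0 t ⊆ Icc 0 c := Icc_subset_Icc_right htc
  have key : (fun ω => leastArgmax c (Γ ω)) ⁻¹' Iic t =
      ⋂ i : ℕ, ⋂ n : ℕ, ⋃ m : ℕ, {ω | Γ ω (v i) - 1 / ((n : ℝ) + 1) < Γ ω (u m)} := by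
    ext ω
    simp only [mem_preimage, mem_Iic, mem_iInter, mem_iUnion, mem_ofPred_eq]
    constructor
    · intro h i n
      have hpos : 0 < 1 / ((n : ℝ) + 1) := Nat.one_div_pos_of_nat
      have hopen : IsOpen {s : Icc 0 t | Γ ω (v i) - 1 / ((n : ℝ) + 1) < Γ ω s} :=
        isOpen_lt continuous_const ((hcont ω).mono hsub).domRestrict
      obtain ⟨m, hm⟩ := hu.exists_mem_open hopen
        ⟨⟨_, (hspec ω).1.1.1, h⟩, by
          have h1 : Γ ω (v i) ≤ Γ ω (leastArgmax c (Γ ω)) := (hspec ω).1.2 (v i).2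
          simp only [mem_ofPred_eq]
          linarith⟩
      exact ⟨m, hm⟩
    · intro h
      obtain ⟨s, hs, hmax⟩ := isCompact_Icc.exists_isMaxOn (nonempty_Icc.2 ht)
        ((hcont ω).mono hsub)
      have h1 : ∀ i, Γ ω (v i) ≤ Γ ω s := by
        intro i
        refine le_of_forall_pos_le_add fun ε hε => ?_
        obtain ⟨n, hn⟩ := exists_nat_one_div_lt hε
        obtain ⟨m, hm⟩ := h i n
        have h2 : Γ ω (u m) ≤ Γ ω s := hmax (u m).2
        linarith
      have hclosed : IsClosed {r : Icc 0 c | Γ ω r ≤ Γ ω s} :=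
        isClosed_le (hcont ω).domRestrict continuous_const
      have h2 : ∀ r : Icc 0 c, Γ ω r ≤ Γ ω s := fun r =>
        hv.induction_on (p := fun r : Icc 0 c => Γ ω r ≤ Γ ω s) r hclosed h1
      exact ((hspec ω).2 ⟨hsub hs, fun r hr => h2 ⟨r, hr⟩⟩).trans hs.2
  rw [key]
  refine MeasurableSet.iInter fun i => MeasurableSet.iInter fun n => MeasurableSet.iUnion fun m => ?_
  exact measurableSet_lt ((hmeas _ (v i).2).sub_const _) (hmeas _ (hsub (u m).2))

/-! ### Monotone weights as averages of upper intervals -/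

/-- A monotone weight with values in `[0, 1]` gives no larger an integral than the best upper
interval. -/
theorem setIntegral_monotoneOn_mul_le {c M : ℝ} (hc : 0 < c) {w y : ℝ → ℝ}
    (hw : IntegrableOn w (Ioc 0 c)) (hy : MonotoneOn y (Ioo 0 c))
    (hmem : ∀ b ∈ Ioo 0 c, y b ∈ Icc (0 : ℝ) 1)
    (hM : ∀ D ∈ Icc 0 c, ∫ b in Ioc D c, w b ≤ M) :
    ∫ b in Ioc 0 c, y b * w b ≤ M := by
  -- Extending `y` by `0` on the left and by `1` on the right makes it monotone on the whole line,
  -- hence measurable, and places `c` in every superlevel set used below.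
  let z : ℝ → ℝ := fun b => if b ≤ 0 then 0 else if b < c then y b else 1
  have hz0 : ∀ b ≤ 0, z b = 0 := fun b hb => if_pos hb
  have hzc : ∀ b, c ≤ b → z b = 1 := fun b hb => by
    simp [z, (hc.trans_le hb).not_ge, hb.not_gt]
  have hzm : ∀ b ∈ Ioo 0 c, z b = y b := fun b hb => by simp [z, hb.1, hb.2]
  have hz01 : ∀ b, z b ∈ Icc (0 : ℝ) 1 := by
    intro b
    rcases le_or_gt b 0 with h | h
    · simp [hz0 b h]
    rcases lt_or_ge b c with h' | h'
    · rw [hzm b ⟨h, h'⟩]; exact hmem b ⟨h, h'⟩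
    · simp [hzc b h']
  have hzmono : Monotone z := by
    intro a b hab
    rcases le_or_gt a 0 with h | h
    · rw [hz0 a h]; exact (hz01 b).1
    rcases lt_or_ge b c with h' | h'
    · rw [hzm b ⟨h.trans_le hab, h'⟩, hzm a ⟨h, hab.trans_lt h'⟩]
      exact hy ⟨h, hab.trans_lt h'⟩ ⟨h.trans_le hab, h'⟩ hab
    · rw [hzc b h']; exact (hz01 a).2
  have hzmeas : Measurable z := hzmono.measurable
  have h1 : ∫ b in Ioc 0 c, y b * w b = ∫ b in Ioc 0 c, z b * w b := by
    rw [integral_Ioc_eq_integral_Ioo,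
      integral_Ioc_eq_integral_Ioo]
    exact setIntegral_congr_fun measurableSet_Ioo fun b hb => by simp only [hzm b hb]
  -- Layer-cake formula: `z b` is the length of the set of levels `t ∈ (0, 1]` with `t ≤ z b`.
  have h2 : ∀ b, z b * w b = ∫ t in Ioc (0 : ℝ) 1, if t ≤ z b then w b else 0 := by
    intro b
    have : (fun t : ℝ => if t ≤ z b then w b else 0) = (Iic (z b)).indicator fun _ => w b := by
      ext t; simp [indicator]
    rw [this, setIntegral_indicator measurableSet_Iic, Ioc_inter_Iic, min_eq_right (hz01 b).2,
      setIntegral_const]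
    simp [(hz01 b).1]
  have hset : MeasurableSet {q : ℝ × ℝ | q.2 ≤ z q.1} :=
    measurableSet_le measurable_snd (hzmeas.comp measurable_fst)
  have hint : Integrable (Function.uncurry fun b t : ℝ => if t ≤ z b then w b else 0)
      ((volume.restrict (Ioc 0 c)).prod (volume.restrict (Ioc (0 : ℝ) 1))) := by
    have h3 : Integrable (fun q : ℝ × ℝ => w q.1)
        ((volume.restrict (Ioc 0 c)).prod (volume.restrict (Ioc (0 : ℝ) 1))) := hw.comp_fst _
    refine (h3.indicator hset).congr (ae_of_all _ fun q => ?_)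
    simp [indicator, Function.uncurry]
  rw [h1]
  simp_rw [h2]
  rw [integral_integral_swap hint]
  -- By monotonicity each superlevel set is an upper interval starting at its infimum; whether it
  -- contains that point does not affect the integral.
  have h4 : ∀ t ∈ Ioc (0 : ℝ) 1, (∫ b in Ioc 0 c, if t ≤ z b then w b else 0) ≤ M := by
    intro t ht
    let A : Set ℝ := {b | b ∈ Icc 0 c ∧ t ≤ z b}
    have hAc : c ∈ A := ⟨⟨hc.le, le_rfl⟩, by rw [hzc c le_rfl]; exact ht.2⟩
    have hAb : BddBelow A := ⟨0, fun b hb => hb.1.1⟩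
    have hD : sInf A ∈ Icc 0 c := ⟨le_csInf ⟨c, hAc⟩ fun b hb => hb.1.1, csInf_le hAb hAc⟩
    refine le_trans (le_of_eq ?_) (hM _ hD)
    have : (fun b : ℝ => if t ≤ z b then w b else 0) = {b | t ≤ z b}.indicator w := by
      ext b; simp [indicator]
    rw [this, setIntegral_indicator (measurableSet_le measurable_const hzmeas)]
    refine setIntegral_congr_set ?_
    have hne : ∀ᵐ b : ℝ, b ≠ sInf A := by simp [ae_iff]
    filter_upwards [hne] with b hb
    refine propext ⟨fun h => ?_, fun h => ?_⟩
    · exact ⟨lt_of_le_of_ne (csInf_le hAb ⟨⟨h.1.1.le, h.1.2⟩, h.2⟩) hb.symm, h.1.2⟩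
    · obtain ⟨a, ha, hab⟩ := (csInf_lt_iff hAb ⟨c, hAc⟩).1 h.1
      exact ⟨⟨hD.1.trans_lt h.1, h.2⟩, ha.2.trans (hzmono hab.le)⟩
  calc _ ≤ ∫ t in Ioc (0 : ℝ) 1, M := by
        refine setIntegral_mono_on hint.integral_prod_right ?_ measurableSet_Ioc h4
        exact integrableOn_const (by simp)
    _ = M := by simp

theorem continuousOn_setIntegral_Ioc_left {c : ℝ} (hc : 0 ≤ c) {w : ℝ → ℝ}
    (hw : IntegrableOn w (Ioc 0 c)) :
    ContinuousOn (fun D => ∫ b in Ioc D c, w b) (Icc 0 c) := by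
  have h1 : IntegrableOn w (uIcc 0 c) := by
    rwa [uIcc_of_le hc, integrableOn_Icc_iff_integrableOn_Ioc]
  have h2 := intervalIntegral.continuousOn_primitive_interval_left h1
  rw [uIcc_of_le hc] at h2
  exact h2.congr fun D hD => (intervalIntegral.integral_of_le hD.2).symm

/-! ### The Lagrangian and the critical rate -/

section Allocations

variable {Ω : Type*} [MeasurableSpace Ω]

theorem measurable_setIntegral_Ioc_left {c : ℝ} {w : Ω → ℝ → ℝ}
    (hw : Measurable (Function.uncurry w)) {D : Ω → ℝ} (hD : Measurable D) :
    Measurable fun ω => ∫ b in Ioc (D ω) c, w ω b := by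
  have hset : MeasurableSet {z : Ω × ℝ | D z.1 < z.2 ∧ z.2 ≤ c} :=
    (measurableSet_lt (hD.comp measurable_fst) measurable_snd).inter
      (measurableSet_le measurable_snd measurable_const)
  have h := (hw.indicator hset).stronglyMeasurable.integral_prod_right
    (f := fun ω b => {z : Ω × ℝ | D z.1 < z.2 ∧ z.2 ≤ c}.indicator (Function.uncurry w) (ω, b))
    (ν := volume)
  convert h.measurable using 2 with ω
  rw [← integral_indicator measurableSet_Ioc]
  rfl

theorem setIntegral_Ioc_antitoneOn {c : ℝ} {w : ℝ → ℝ} (hw : IntegrableOn w (Ioc 0 c))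
    (h0 : ∀ b, 0 ≤ w b) : AntitoneOn (fun D => ∫ b in Ioc D c, w b) (Ici 0) := by
  intro D hD D' _ hle
  exact setIntegral_mono_set (hw.mono_set (Ioc_subset_Ioc_left hD)) (ae_of_all _ h0)
    (Ioc_subset_Ioc_left hle).eventuallyLE

/-- The gain from full coverage above `D` when each unit of `k` is charged at the rate `r`. -/
def lagrangian (c : ℝ) (ψ k : ℝ → ℝ) (r D : ℝ) : ℝ :=
  (∫ b in Ioc D c, ψ b) - r * ∫ b in Ioc D c, k b

theorem continuousOn_lagrangian {c : ℝ} (hc : 0 ≤ c) {ψ k : ℝ → ℝ}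
    (hψ : IntegrableOn ψ (Ioc 0 c)) (hk : IntegrableOn k (Ioc 0 c)) (r : ℝ) :
    ContinuousOn (lagrangian c ψ k r) (Icc 0 c) :=
  (continuousOn_setIntegral_Ioc_left hc hψ).sub
    (continuousOn_const.mul (continuousOn_setIntegral_Ioc_left hc hk))

/-- Monotone comparative statics: a higher rate penalizes low thresholds more, since they leave a
larger integral of `k`. -/
theorem leastArgmax_lagrangian_mono {c : ℝ} (hc : 0 ≤ c) {ψ k : ℝ → ℝ}
    (hψ : IntegrableOn ψ (Ioc 0 c)) (hk : IntegrableOn k (Ioc 0 c)) (hk0 : ∀ b, 0 ≤ k b) :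
    Monotone fun r => leastArgmax c (lagrangian c ψ k r) := by
  intro r s hrs
  have hr := isLeast_leastArgmax hc (continuousOn_lagrangian hc hψ hk r)
  have hs := isLeast_leastArgmax hc (continuousOn_lagrangian hc hψ hk s)
  simp only
  set D := leastArgmax c (lagrangian c ψ k r)
  set D' := leastArgmax c (lagrangian c ψ k s)
  by_contra! hlt
  -- The inequality is strict because a tie would make `D'` a maximizer below the smallest one.
  have h1 : lagrangian c ψ k r D' < lagrangian c ψ k r D := by
    by_contra! hle
    exact hlt.not_ge (hr.2 ⟨hs.1.1, fun x hx => (hr.1.2 hx).trans hle⟩)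
  have h2 : lagrangian c ψ k s D ≤ lagrangian c ψ k s D' := hs.1.2 hr.1.1
  have h3 := setIntegral_Ioc_antitoneOn hk hk0 hs.1.1.1 hr.1.1.1 hlt.le
  simp only [lagrangian] at h1 h2 h3
  nlinarith

/-- The Lagrangian is jointly continuous in rate and threshold, so the argmax correspondence has a
closed graph. -/
theorem tendsto_isMaxOn_lagrangian {c : ℝ} (hc : 0 ≤ c) {ψ k : ℝ → ℝ}
    (hψ : IntegrableOn ψ (Ioc 0 c)) (hk : IntegrableOn k (Ioc 0 c)) {r D : ℕ → ℝ} {r₀ D₀ : ℝ}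
    (hr : Tendsto r atTop (𝓝 r₀)) (hD : Tendsto D atTop (𝓝 D₀)) (hmem : ∀ n, D n ∈ Icc 0 c)
    (hmax : ∀ n, IsMaxOn (lagrangian c ψ k (r n)) (Icc 0 c) (D n)) :
    D₀ ∈ Icc 0 c ∧ IsMaxOn (lagrangian c ψ k r₀) (Icc 0 c) D₀ ∧
      Tendsto (fun n => ∫ b in Ioc (D n) c, k b) atTop (𝓝 (∫ b in Ioc D₀ c, k b)) := by
  have hD₀ : D₀ ∈ Icc 0 c := isClosed_Icc.mem_of_tendsto hD (Eventually.of_forall hmem)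
  have hD' : Tendsto D atTop (𝓝[Icc 0 c] D₀) :=
    tendsto_nhdsWithin_iff.2 ⟨hD, Eventually.of_forall hmem⟩
  have hk' := (continuousOn_setIntegral_Ioc_left hc hk D₀ hD₀).tendsto.comp hD'
  have hψ' := (continuousOn_setIntegral_Ioc_left hc hψ D₀ hD₀).tendsto.comp hD'
  refine ⟨hD₀, fun x hx => ?_, hk'⟩
  refine le_of_tendsto_of_tendsto' (tendsto_const_nhds.sub (hr.mul tendsto_const_nhds))
    (hψ'.sub (hr.mul hk')) fun n => hmax n hx

/-- The total `Q r` under the smallest optimal thresholds decreases from the full integral of `k` to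
`0`, but may jump over `R`. The one-sided limits of the thresholds at the crossing rate supply both
sides of the jump. -/
theorem exists_threshold_pair {μ : Measure Ω} [SFinite μ] {c : ℝ} (hc : 0 < c)
    {ψ k : Ω → ℝ → ℝ} (hψm : Measurable (Function.uncurry ψ))
    (hkm : Measurable (Function.uncurry k))
    (hψs : ∀ ω, IntegrableOn (ψ ω) (Ioc 0 c)) (hks : ∀ ω, IntegrableOn (k ω) (Ioc 0 c))
    (hk0 : ∀ ω b, 0 ≤ k ω b)
    (hψi : Integrable (Function.uncurry ψ) (μ.prod (volume.restrict (Ioc 0 c))))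
    (hki : Integrable (Function.uncurry k) (μ.prod (volume.restrict (Ioc 0 c))))
    {R : ℝ} (hR0 : 0 < R) (hR1 : R < ∫ ω, (∫ b in Ioc 0 c, k ω b) ∂μ) :
    ∃ (r : ℝ) (D₁ D₂ : Ω → ℝ), Measurable D₁ ∧ Measurable D₂ ∧
      (∀ ω, 0 ≤ D₁ ω ∧ D₁ ω ≤ D₂ ω ∧ D₂ ω ≤ c) ∧
      (∀ ω, IsMaxOn (lagrangian c (ψ ω) (k ω) r) (Icc 0 c) (D₁ ω)) ∧
      (∀ ω, IsMaxOn (lagrangian c (ψ ω) (k ω) r) (Icc 0 c) (D₂ ω)) ∧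
      (∫ ω, (∫ b in Ioc (D₂ ω) c, k ω b) ∂μ) ≤ R ∧
      R ≤ ∫ ω, (∫ b in Ioc (D₁ ω) c, k ω b) ∂μ := by
  let T : ℝ → Ω → ℝ := fun r ω => leastArgmax c (lagrangian c (ψ ω) (k ω) r)
  have hT := fun r ω =>
    isLeast_leastArgmax hc.le (continuousOn_lagrangian hc.le (hψs ω) (hks ω) r)
  have hTmem : ∀ r ω, T r ω ∈ Icc 0 c := fun r ω => (hT r ω).1.1
  have hTmono : ∀ ω, Monotone fun r => T r ω := fun ω =>
    leastArgmax_lagrangian_mono hc.le (hψs ω) (hks ω) (hk0 ω)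
  have hTmeas : ∀ r, Measurable (T r) := fun r =>
    measurable_leastArgmax hc.le (fun ω => continuousOn_lagrangian hc.le (hψs ω) (hks ω) r)
      fun D _ => (measurable_setIntegral_Ioc_left hψm measurable_const).sub
        ((measurable_setIntegral_Ioc_left hkm measurable_const).const_mul r)
  have hk_le : ∀ ω, ∀ D ∈ Icc 0 c, ∫ b in Ioc D c, k ω b ≤ ∫ b in Ioc 0 c, k ω b :=
    fun ω D hD => setIntegral_Ioc_antitoneOn (hks ω) (hk0 ω) self_mem_Ici hD.1 hD.1
  have hk_nn : ∀ ω D, 0 ≤ ∫ b in Ioc D c, k ω b := fun ω D =>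
    setIntegral_nonneg measurableSet_Ioc fun b _ => hk0 ω b
  have hK : Integrable (fun ω => ∫ b in Ioc 0 c, k ω b) μ := hki.integral_prod_left
  have hP : Integrable (fun ω => ∫ b in Ioc 0 c, |ψ ω b|) μ := hψi.norm.integral_prod_left
  have hψ_le : ∀ ω, ∀ D ∈ Icc 0 c, |∫ b in Ioc D c, ψ ω b| ≤ ∫ b in Ioc 0 c, |ψ ω b| := by
    intro ω D hD
    refine (abs_integral_le_integral_abs).trans ?_
    exact setIntegral_mono_set (hψs ω).abs (ae_of_all _ fun _ => abs_nonneg _)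
      (Ioc_subset_Ioc_left hD.1).eventuallyLE
  have hint : ∀ D : Ω → ℝ, Measurable D → (∀ ω, D ω ∈ Icc 0 c) →
      Integrable (fun ω => ∫ b in Ioc (D ω) c, k ω b) μ := by
    intro D hD hDm
    refine hK.mono' (measurable_setIntegral_Ioc_left hkm hD).aestronglyMeasurable
      (ae_of_all _ fun ω => ?_)
    rw [Real.norm_of_nonneg (hk_nn _ _)]
    exact hk_le ω _ (hDm ω)
  let Q : ℝ → ℝ := fun r => ∫ ω, (∫ b in Ioc (T r ω) c, k ω b) ∂μ
  have hQanti : Antitone Q := fun r s hrs =>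
    integral_mono (hint _ (hTmeas s) (hTmem s)) (hint _ (hTmeas r) (hTmem r)) fun ω =>
      setIntegral_Ioc_antitoneOn (hks ω) (hk0 ω) (hTmem r ω).1 (hTmem s ω).1 (hTmono ω hrs)
  set P := ∫ ω, (∫ b in Ioc 0 c, |ψ ω b|) ∂μ with hPdef
  set K := ∫ ω, (∫ b in Ioc 0 c, k ω b) ∂μ with hKdef
  -- Comparison with the threshold `c`, whose Lagrangian is zero, forces `Q r` to `0` as `r → ∞`.
  have hup : ∀ r, 0 ≤ r → r * Q r ≤ P := by
    intro r hr
    simp only [Q]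
    rw [← integral_const_mul]
    refine integral_mono ((hint _ (hTmeas r) (hTmem r)).const_mul r) hP fun ω => ?_
    have h1 : lagrangian c (ψ ω) (k ω) r c ≤ lagrangian c (ψ ω) (k ω) r (T r ω) :=
      (hT r ω).1.2 (right_mem_Icc.2 hc.le)
    have h2 := (abs_le.1 (hψ_le ω _ (hTmem r ω))).2
    simp only [lagrangian, Ioc_self, setIntegral_empty] at h1
    simp only
    linarith
  -- Comparison with the threshold `0` forces `Q (-r)` to the full integral `K` as `r → ∞`.
  have hlow : ∀ r, 0 ≤ r → r * (K - Q (-r)) ≤ 2 * P := by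
    intro r hr
    simp only [Q, hKdef]
    rw [← integral_sub hK (hint _ (hTmeas _) (hTmem _)), ← integral_const_mul, hPdef,
      ← integral_const_mul]
    refine integral_mono ((hK.sub (hint _ (hTmeas _) (hTmem _))).const_mul r) (hP.const_mul 2)
      fun ω => ?_
    have h1 : lagrangian c (ψ ω) (k ω) (-r) 0 ≤ lagrangian c (ψ ω) (k ω) (-r) (T (-r) ω) :=
      (hT (-r) ω).1.2 (left_mem_Icc.2 hc.le)
    have h2 := (abs_le.1 (hψ_le ω _ (hTmem (-r) ω))).2
    have h3 := (abs_le.1 (hψ_le ω 0 (left_mem_Icc.2 hc.le))).1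
    simp only [lagrangian] at h1
    simp only
    linarith
  have hP0 : 0 ≤ P := integral_nonneg fun ω => integral_nonneg fun b => abs_nonneg _
  let L : Set ℝ := {r | R ≤ Q r}
  have hLne : L.Nonempty := by
    -- At this rate `Q < R` would give `r * (K - Q (-r)) ≥ 2 * P + 1`, against `hlow`.
    refine ⟨-((2 * P + 1) / (K - R)), ?_⟩
    have hKR : 0 < K - R := sub_pos.2 hR1
    have h := hlow ((2 * P + 1) / (K - R)) (by positivity)
    change R ≤ Q _
    by_contra! hlt
    have h1 : (2 * P + 1) / (K - R) * (K - R) = 2 * P + 1 := div_mul_cancel₀ _ hKR.ne'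
    have h2 : (2 * P + 1) / (K - R) * (K - R) ≤
        (2 * P + 1) / (K - R) * (K - Q (-((2 * P + 1) / (K - R)))) :=
      mul_le_mul_of_nonneg_left (by linarith) (by positivity)
    linarith
  have hLbdd : BddAbove L := by
    refine ⟨(P + 1) / R, fun r hr => ?_⟩
    by_contra! hlt
    have h0 : 0 < (P + 1) / R := by positivity
    have h := hup r (h0.trans hlt).le
    have h1 : (P + 1) / R * R = P + 1 := div_mul_cancel₀ _ hR0.ne'
    have h2 : (P + 1) / R * R ≤ r * Q r :=
      mul_le_mul hlt.le hr hR0.le (h0.trans hlt).le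
    linarith
  set r₀ := sSup L
  let e : ℕ → ℝ := fun n => 1 / ((n : ℝ) + 1)
  have he : Tendsto e atTop (𝓝 0) := tendsto_one_div_add_atTop_nhds_zero_nat
  have hepos : ∀ n, 0 < e n := fun n => Nat.one_div_pos_of_nat
  have heanti : Antitone e := fun m n hmn => Nat.one_div_le_one_div hmn
  have hlo : ∀ n, R ≤ Q (r₀ - e n) := by
    intro n
    obtain ⟨r, hr, hlt⟩ := exists_lt_of_lt_csSup hLne (sub_lt_self r₀ (hepos n))
    exact le_trans hr (hQanti hlt.le)
  have hhi : ∀ n, Q (r₀ + e n) ≤ R := by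
    intro n
    by_contra! hlt
    have : r₀ + e n ≤ r₀ := le_csSup hLbdd hlt.le
    linarith [hepos n]
  have hm₁ : ∀ ω, Monotone fun n => T (r₀ - e n) ω := fun ω m n hmn =>
    hTmono ω (sub_le_sub_left (heanti hmn) r₀)
  have hm₂ : ∀ ω, Antitone fun n => T (r₀ + e n) ω := fun ω m n hmn =>
    hTmono ω (by simpa using heanti hmn)
  -- Left and right limits at `r₀` of the threshold as a function of the rate.
  let D₁ : Ω → ℝ := fun ω => ⨆ n, T (r₀ - e n) ω
  let D₂ : Ω → ℝ := fun ω => ⨅ n, T (r₀ + e n) ω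
  have ht₁ : ∀ ω, Tendsto (fun n => T (r₀ - e n) ω) atTop (𝓝 (D₁ ω)) := fun ω =>
    tendsto_atTop_ciSup (hm₁ ω) ⟨c, by rintro _ ⟨n, rfl⟩; exact (hTmem _ ω).2⟩
  have ht₂ : ∀ ω, Tendsto (fun n => T (r₀ + e n) ω) atTop (𝓝 (D₂ ω)) := fun ω =>
    tendsto_atTop_ciInf (hm₂ ω) ⟨0, by rintro _ ⟨n, rfl⟩; exact (hTmem _ ω).1⟩
  have hr₁ : Tendsto (fun n => r₀ - e n) atTop (𝓝 r₀) := by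
    simpa using tendsto_const_nhds.sub he
  have hr₂ : Tendsto (fun n => r₀ + e n) atTop (𝓝 r₀) := by
    simpa using tendsto_const_nhds.add he
  have h₁ := fun ω => tendsto_isMaxOn_lagrangian hc.le (hψs ω) (hks ω) hr₁ (ht₁ ω)
    (fun n => hTmem _ ω) fun n => (hT _ ω).1.2
  have h₂ := fun ω => tendsto_isMaxOn_lagrangian hc.le (hψs ω) (hks ω) hr₂ (ht₂ ω)
    (fun n => hTmem _ ω) fun n => (hT _ ω).1.2
  have hconv : ∀ (s : ℕ → ℝ) (D : Ω → ℝ),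
      (∀ ω, Tendsto (fun n => ∫ b in Ioc (T (s n) ω) c, k ω b) atTop
        (𝓝 (∫ b in Ioc (D ω) c, k ω b))) →
      Tendsto (fun n => Q (s n)) atTop (𝓝 (∫ ω, (∫ b in Ioc (D ω) c, k ω b) ∂μ)) := by
    intro s D hlim
    refine tendsto_integral_of_dominated_convergence _
      (fun n => (hint _ (hTmeas (s n)) (hTmem (s n))).aestronglyMeasurable) hK
      (fun n => ae_of_all _ fun ω => ?_) (ae_of_all _ hlim)
    rw [Real.norm_of_nonneg (hk_nn _ _)]
    exact hk_le ω _ (hTmem _ ω)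
  refine ⟨r₀, D₁, D₂, measurable_of_tendsto_metrizable (fun n => hTmeas _) (tendsto_pi_nhds.2 ht₁),
    measurable_of_tendsto_metrizable (fun n => hTmeas _) (tendsto_pi_nhds.2 ht₂),
    fun ω => ⟨(h₁ ω).1.1, ?_, (h₂ ω).1.2⟩, fun ω => (h₁ ω).2.1, fun ω => (h₂ ω).2.1, ?_, ?_⟩
  · exact le_of_tendsto_of_tendsto' (ht₁ ω) (ht₂ ω) fun n => hTmono ω (by linarith [hepos n])
  · exact le_of_tendsto' (hconv _ D₂ fun ω => (h₂ ω).2.2) hhi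
  · exact ge_of_tendsto' (hconv _ D₁ fun ω => (h₁ ω).2.2) hlo

/-! ### Two-tier allocations and their optimality -/

/-- The allocation without coverage up to `D₁`, with coverage `α` up to `D₂`, and with full
coverage above `D₂`. -/
def tiers (α D₁ D₂ b : ℝ) : ℝ := if D₂ < b then 1 else if D₁ < b then α else 0

theorem tiers_eq_indicator {α D₁ D₂ : ℝ} (h : D₁ ≤ D₂) (b : ℝ) :
    tiers α D₁ D₂ b =
      α * (Ioi D₁).indicator 1 b + (1 - α) * (Ioi D₂).indicator 1 b := by
  unfold tiers
  by_cases h2 : D₂ < b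
  · simp [h2, h.trans_lt h2]
  · by_cases h1 : D₁ < b <;> simp [h1, h2]

theorem tiers_mem_Icc {α : ℝ} (hα : α ∈ Ioo (0 : ℝ) 1) (D₁ D₂ b : ℝ) :
    tiers α D₁ D₂ b ∈ Icc (0 : ℝ) 1 := by
  unfold tiers
  split_ifs
  · simp
  · exact ⟨hα.1.le, hα.2.le⟩
  · simp

theorem tiers_monotone {α : ℝ} (hα : α ∈ Ioo (0 : ℝ) 1) (D₁ D₂ : ℝ) :
    Monotone (tiers α D₁ D₂) := by
  intro a b hab
  have := hα.1
  have := hα.2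
  unfold tiers
  split_ifs <;> linarith

theorem setIntegral_tiers_mul {c α D₁ D₂ : ℝ} (h0 : 0 ≤ D₁) (h : D₁ ≤ D₂) {w : ℝ → ℝ}
    (hw : IntegrableOn w (Ioc 0 c)) :
    ∫ b in Ioc 0 c, tiers α D₁ D₂ b * w b =
      α * (∫ b in Ioc D₁ c, w b) + (1 - α) * ∫ b in Ioc D₂ c, w b := by
  have h1 : ∀ D, 0 ≤ D → ∫ b in Ioc D c, w b = ∫ b in Ioc 0 c, (Ioi D).indicator w b := by
    intro D hD
    rw [setIntegral_indicator measurableSet_Ioi, Ioc_inter_Ioi, max_eq_right hD]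
  have h2 : ∀ D, IntegrableOn ((Ioi D).indicator w) (Ioc 0 c) := fun D =>
    hw.indicator measurableSet_Ioi
  rw [h1 _ h0, h1 _ (h0.trans h), ← integral_const_mul, ← integral_const_mul,
    ← integral_add ((h2 D₁).const_mul α) ((h2 D₂).const_mul (1 - α))]
  refine integral_congr_ae (ae_of_all _ fun b => ?_)
  simp only [tiers_eq_indicator h]
  simp only [indicator, Pi.one_apply]
  split_ifs <;> ring

theorem measurable_tiers {α : ℝ} {D₁ D₂ : Ω → ℝ} (h₁ : Measurable D₁) (h₂ : Measurable D₂) :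
    Measurable fun z : Ω × ℝ => tiers α (D₁ z.1) (D₂ z.1) z.2 :=
  Measurable.ite (measurableSet_lt (h₂.comp measurable_fst) measurable_snd) measurable_const
    (Measurable.ite (measurableSet_lt (h₁.comp measurable_fst) measurable_snd) measurable_const
      measurable_const)

/-- Allocations on `Ω × (0, c)` that are non-decreasing in the second variable, up to null sets
of the first. -/
structure IsMonotoneAllocation (μ : Measure Ω) (c : ℝ) (y : Ω → ℝ → ℝ) : Prop where
  aemeasurable : AEMeasurable (Function.uncurry y) (μ.prod (volume.restrict (Ioc 0 c)))
  mono : ∀ᵐ ω ∂μ, MonotoneOn (y ω) (Ioo 0 c)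
  mem_unit : ∀ᵐ ω ∂μ, ∀ b ∈ Ioo 0 c, y ω b ∈ Icc (0 : ℝ) 1

theorem IsMonotoneAllocation.ae_mem {μ : Measure Ω} [SFinite μ] {c : ℝ} {y : Ω → ℝ → ℝ}
    (hy : IsMonotoneAllocation μ c y) :
    ∀ᵐ z ∂μ.prod (volume.restrict (Ioc 0 c)), Function.uncurry y z ∈ Icc (0 : ℝ) 1 := by
  have h1 := Measure.quasiMeasurePreserving_fst (μ := μ)
    (ν := volume.restrict (Ioc 0 c)) |>.ae hy.mem_unit
  have h2 : ∀ᵐ b ∂volume.restrict (Ioc 0 c), b ∈ Ioo 0 c := by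
    rw [Measure.restrict_congr_set Ioo_ae_eq_Ioc.symm]
    exact ae_restrict_mem measurableSet_Ioo
  have h3 := Measure.quasiMeasurePreserving_snd (μ := μ)
    (ν := volume.restrict (Ioc 0 c)) |>.ae h2
  filter_upwards [h1, h3] with z hz hz' using hz _ hz'

theorem IsMonotoneAllocation.integrable_mul {μ : Measure Ω} [SFinite μ] {c : ℝ} {y : Ω → ℝ → ℝ}
    (hy : IsMonotoneAllocation μ c y) {w : Ω × ℝ → ℝ}
    (hw : Integrable w (μ.prod (volume.restrict (Ioc 0 c)))) :
    Integrable (fun z => Function.uncurry y z * w z) (μ.prod (volume.restrict (Ioc 0 c))) := by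
  refine hw.bdd_mul (c := 1) hy.aemeasurable.aestronglyMeasurable ?_
  filter_upwards [hy.ae_mem] with z hz
  rw [Real.norm_of_nonneg hz.1]
  exact hz.2

theorem isMonotoneAllocation_tiers (μ : Measure Ω) (c : ℝ) {α : ℝ} (hα : α ∈ Ioo (0 : ℝ) 1)
    {D₁ D₂ : Ω → ℝ} (h₁ : Measurable D₁) (h₂ : Measurable D₂) :
    IsMonotoneAllocation μ c fun ω => tiers α (D₁ ω) (D₂ ω) where
  aemeasurable := (measurable_tiers h₁ h₂).aemeasurable
  mono := ae_of_all _ fun _ => (tiers_monotone hα _ _).monotoneOn _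
  mem_unit := ae_of_all _ fun _ b _ => tiers_mem_Icc hα _ _ b

theorem integral_tiers_mul {μ : Measure Ω} [SFinite μ] {c α : ℝ} (hα : α ∈ Ioo (0 : ℝ) 1)
    {D₁ D₂ : Ω → ℝ} (h₁ : Measurable D₁) (h₂ : Measurable D₂)
    (h0 : ∀ ω, 0 ≤ D₁ ω) (h : ∀ ω, D₁ ω ≤ D₂ ω) {w : Ω → ℝ → ℝ}
    (hws : ∀ ω, IntegrableOn (w ω) (Ioc 0 c))
    (hw : Integrable (Function.uncurry w) (μ.prod (volume.restrict (Ioc 0 c)))) :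
    ∫ z, tiers α (D₁ z.1) (D₂ z.1) z.2 * Function.uncurry w z
        ∂μ.prod (volume.restrict (Ioc 0 c)) =
      ∫ ω, (α * (∫ b in Ioc (D₁ ω) c, w ω b) + (1 - α) * ∫ b in Ioc (D₂ ω) c, w ω b) ∂μ := by
  have hi := (isMonotoneAllocation_tiers μ c hα h₁ h₂).integrable_mul hw
  refine (integral_prod _ hi).trans (integral_congr_ae (ae_of_all _ fun ω => ?_))
  exact setIntegral_tiers_mul (h0 ω) (h ω) (hws ω)

/-- Charging the constraint at the rate `r` turns thresholds that maximize the Lagrangian into an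
optimal allocation. -/
theorem integral_mul_le_of_isMaxOn {μ : Measure Ω} [SFinite μ] {c α r : ℝ} (hc : 0 < c)
    (hα : α ∈ Ioo (0 : ℝ) 1) {D₁ D₂ : Ω → ℝ} (h₁ : Measurable D₁) (h₂ : Measurable D₂)
    (hD : ∀ ω, 0 ≤ D₁ ω ∧ D₁ ω ≤ D₂ ω ∧ D₂ ω ≤ c) {ψ k : Ω → ℝ → ℝ}
    (hψs : ∀ ω, IntegrableOn (ψ ω) (Ioc 0 c)) (hks : ∀ ω, IntegrableOn (k ω) (Ioc 0 c))
    (hψi : Integrable (Function.uncurry ψ) (μ.prod (volume.restrict (Ioc 0 c))))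
    (hki : Integrable (Function.uncurry k) (μ.prod (volume.restrict (Ioc 0 c))))
    (hm₁ : ∀ ω, IsMaxOn (lagrangian c (ψ ω) (k ω) r) (Icc 0 c) (D₁ ω))
    (hm₂ : ∀ ω, IsMaxOn (lagrangian c (ψ ω) (k ω) r) (Icc 0 c) (D₂ ω))
    {y : Ω → ℝ → ℝ} (hy : IsMonotoneAllocation μ c y)
    (heq : ∫ z, Function.uncurry y z * Function.uncurry k z ∂μ.prod (volume.restrict (Ioc 0 c)) =
      ∫ z, tiers α (D₁ z.1) (D₂ z.1) z.2 * Function.uncurry k z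
        ∂μ.prod (volume.restrict (Ioc 0 c))) :
    ∫ z, Function.uncurry y z * Function.uncurry ψ z ∂μ.prod (volume.restrict (Ioc 0 c)) ≤
      ∫ z, tiers α (D₁ z.1) (D₂ z.1) z.2 * Function.uncurry ψ z
        ∂μ.prod (volume.restrict (Ioc 0 c)) := by
  have hx := isMonotoneAllocation_tiers μ c hα h₁ h₂
  have hw : Integrable (fun z => Function.uncurry ψ z - r * Function.uncurry k z)
      (μ.prod (volume.restrict (Ioc 0 c))) := hψi.sub (hki.const_mul r)
  -- Both allocations give the same integral against `k`, so the charge `r` adds the same constant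
  -- to each side.
  have hsplit : ∀ {v : Ω → ℝ → ℝ}, IsMonotoneAllocation μ c v →
      ∫ z, Function.uncurry v z * Function.uncurry ψ z ∂μ.prod (volume.restrict (Ioc 0 c)) =
        (∫ z, Function.uncurry v z * (Function.uncurry ψ z - r * Function.uncurry k z)
          ∂μ.prod (volume.restrict (Ioc 0 c))) +
        r * ∫ z, Function.uncurry v z * Function.uncurry k z
          ∂μ.prod (volume.restrict (Ioc 0 c)) := by
    intro v hv
    rw [← integral_const_mul, ← integral_add (hv.integrable_mul hw)
      ((hv.integrable_mul hki).const_mul r)]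
    exact integral_congr_ae (ae_of_all _ fun z => by ring)
  have hx' := hsplit hx
  have hy' := hsplit hy
  rw [hy', heq]
  refine le_trans (add_le_add_left ?_ _) hx'.ge
  rw [integral_prod _ (hy.integrable_mul hw), integral_prod _ (hx.integrable_mul hw)]
  refine integral_mono_ae (hy.integrable_mul hw).integral_prod_left
    (hx.integrable_mul hw).integral_prod_left ?_
  filter_upwards [hy.mono, hy.mem_unit] with ω hmono hmem
  have hws : IntegrableOn (fun b => ψ ω b - r * k ω b) (Ioc 0 c) :=
    (hψs ω).sub ((hks ω).const_mul r)
  have htail : ∀ D, 0 ≤ D →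
      ∫ b in Ioc D c, (ψ ω b - r * k ω b) = lagrangian c (ψ ω) (k ω) r D := by
    intro D hD0
    have hsub : Ioc D c ⊆ Ioc 0 c := Ioc_subset_Ioc_left hD0
    rw [integral_sub ((hψs ω).mono_set hsub) (((hks ω).mono_set hsub).const_mul r),
      integral_const_mul, lagrangian]
  obtain ⟨h0, h12, h2⟩ := hD ω
  have hmem₁ : D₁ ω ∈ Icc 0 c := ⟨h0, h12.trans h2⟩
  have hmem₂ : D₂ ω ∈ Icc 0 c := ⟨h0.trans h12, h2⟩
  -- Both thresholds are maximizers, hence of equal value, so any weight between them is optimal.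
  have hval : lagrangian c (ψ ω) (k ω) r (D₂ ω) = lagrangian c (ψ ω) (k ω) r (D₁ ω) :=
    le_antisymm (hm₁ ω hmem₂) (hm₂ ω hmem₁)
  calc ∫ b in Ioc 0 c, y ω b * (ψ ω b - r * k ω b)
      ≤ lagrangian c (ψ ω) (k ω) r (D₁ ω) :=
        setIntegral_monotoneOn_mul_le hc hws hmono hmem fun D hD' => by
          rw [htail D hD'.1]; exact hm₁ ω hD'
    _ = ∫ b in Ioc 0 c, tiers α (D₁ ω) (D₂ ω) b * (ψ ω b - r * k ω b) := by
        rw [setIntegral_tiers_mul h0 h12 hws, htail _ h0, htail _ (h0.trans h12), hval]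
        ring

/-- The extreme values of `R` are treated apart, since there a finite multiplier need not exist.
Positivity of `k` then forces every admissible allocation to be `0`, respectively `1`, almost
everywhere. In between, two thresholds are mixed at the critical rate. -/
theorem exists_optimal_tiers_of_measurable {μ : Measure Ω} [SFinite μ] {c : ℝ} (hc : 0 < c)
    {ψ k : Ω → ℝ → ℝ} (hψm : Measurable (Function.uncurry ψ))
    (hkm : Measurable (Function.uncurry k))
    (hψs : ∀ ω, IntegrableOn (ψ ω) (Ioc 0 c)) (hks : ∀ ω, IntegrableOn (k ω) (Ioc 0 c))
    (hk0 : ∀ ω b, 0 ≤ k ω b)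
    (hψi : Integrable (Function.uncurry ψ) (μ.prod (volume.restrict (Ioc 0 c))))
    (hki : Integrable (Function.uncurry k) (μ.prod (volume.restrict (Ioc 0 c))))
    (hkpos : ∀ᵐ z ∂μ.prod (volume.restrict (Ioc 0 c)), 0 < Function.uncurry k z)
    {R : ℝ} (hR0 : 0 ≤ R)
    (hR1 : R ≤ ∫ z, Function.uncurry k z ∂μ.prod (volume.restrict (Ioc 0 c))) :
    ∃ (α : ℝ) (D₁ D₂ : Ω → ℝ), α ∈ Ioo (0 : ℝ) 1 ∧ Measurable D₁ ∧ Measurable D₂ ∧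
      (∀ ω, 0 ≤ D₁ ω ∧ D₁ ω ≤ D₂ ω ∧ D₂ ω ≤ c) ∧
      ∫ z, tiers α (D₁ z.1) (D₂ z.1) z.2 * Function.uncurry k z
        ∂μ.prod (volume.restrict (Ioc 0 c)) = R ∧
      ∀ y, IsMonotoneAllocation μ c y →
        ∫ z, Function.uncurry y z * Function.uncurry k z
          ∂μ.prod (volume.restrict (Ioc 0 c)) = R →
        ∫ z, Function.uncurry y z * Function.uncurry ψ z
          ∂μ.prod (volume.restrict (Ioc 0 c)) ≤
        ∫ z, tiers α (D₁ z.1) (D₂ z.1) z.2 * Function.uncurry ψ z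
          ∂μ.prod (volume.restrict (Ioc 0 c)) := by
  have hhalf : (1 / 2 : ℝ) ∈ Ioo (0 : ℝ) 1 := by norm_num
  rcases hR0.eq_or_lt with hR | hR
  · have hx : ∀ {w : Ω → ℝ → ℝ}, (∀ ω, IntegrableOn (w ω) (Ioc 0 c)) →
        Integrable (Function.uncurry w) (μ.prod (volume.restrict (Ioc 0 c))) →
        ∫ z : Ω × ℝ, tiers (1 / 2) c c z.2 * Function.uncurry w z
          ∂μ.prod (volume.restrict (Ioc 0 c)) = 0 := by
      intro w hws hw
      rw [integral_tiers_mul hhalf measurable_const measurable_const (fun _ => hc.le)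
        (fun _ => le_rfl) hws hw]
      simp
    refine ⟨1 / 2, fun _ => c, fun _ => c, hhalf, measurable_const, measurable_const,
      fun _ => ⟨hc.le, le_rfl, le_rfl⟩, (hx hks hki).trans hR, fun y hy heq => ?_⟩
    rw [hx hψs hψi]
    refine le_of_eq (integral_eq_zero_of_ae ?_)
    rw [← hR, integral_eq_zero_iff_of_nonneg_ae ?_ (hy.integrable_mul hki)] at heq
    · filter_upwards [heq, hkpos] with z hz hkz
      have : Function.uncurry y z = 0 := by simpa [hkz.ne'] using hz
      simp [this]
    · filter_upwards [hy.ae_mem, hkpos] with z hz hkz using mul_nonneg hz.1 hkz.le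
  rcases hR1.eq_or_lt with hR' | hR'
  · have hx : ∀ {w : Ω → ℝ → ℝ}, (∀ ω, IntegrableOn (w ω) (Ioc 0 c)) →
        Integrable (Function.uncurry w) (μ.prod (volume.restrict (Ioc 0 c))) →
        ∫ z : Ω × ℝ, tiers (1 / 2) 0 0 z.2 * Function.uncurry w z
          ∂μ.prod (volume.restrict (Ioc 0 c)) =
        ∫ z, Function.uncurry w z ∂μ.prod (volume.restrict (Ioc 0 c)) := by
      intro w hws hw
      rw [integral_tiers_mul hhalf measurable_const measurable_const (fun _ => le_rfl)
        (fun _ => le_rfl) hws hw, integral_prod _ hw]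
      refine integral_congr_ae (ae_of_all _ fun ω => ?_)
      simp only [Function.uncurry_apply_pair]
      ring
    refine ⟨1 / 2, fun _ => 0, fun _ => 0, hhalf, measurable_const, measurable_const,
      fun _ => ⟨le_rfl, le_rfl, hc.le⟩, (hx hks hki).trans hR'.symm, fun y hy heq => ?_⟩
    rw [hx hψs hψi]
    have hyk := hy.integrable_mul hki
    have hdiff : Integrable
        (fun z => Function.uncurry k z - Function.uncurry y z * Function.uncurry k z)
        (μ.prod (volume.restrict (Ioc 0 c))) := hki.sub hyk
    have hzero : ∫ z, (Function.uncurry k z - Function.uncurry y z * Function.uncurry k z)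
        ∂μ.prod (volume.restrict (Ioc 0 c)) = 0 := by
      rw [integral_sub hki hyk, heq, ← hR', sub_self]
    rw [integral_eq_zero_iff_of_nonneg_ae ?_ hdiff] at hzero
    · refine le_of_eq (integral_congr_ae ?_)
      filter_upwards [hzero, hkpos] with z hz hkz
      have h1 : (1 - Function.uncurry y z) * Function.uncurry k z = 0 := by
        simp only [Pi.zero_apply] at hz
        linarith
      have h2 : Function.uncurry y z = 1 := by
        rcases mul_eq_zero.1 h1 with h | h
        · linarith
        · exact absurd h hkz.ne'
      simp only [h2, one_mul]
    · filter_upwards [hy.ae_mem, hkpos] with z hz hkz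
      have := mul_nonneg (sub_nonneg.2 hz.2) hkz.le
      simp only [Pi.zero_apply]
      linarith
  rw [integral_prod _ hki] at hR'
  obtain ⟨r, D₁, D₂, hD₁, hD₂, hD, hm₁, hm₂, hle, hge⟩ :=
    exists_threshold_pair hc hψm hkm hψs hks hk0 hψi hki hR hR'
  have hint : ∀ D : Ω → ℝ, Measurable D → (∀ ω, 0 ≤ D ω) →
      Integrable (fun ω => ∫ b in Ioc (D ω) c, k ω b) μ := by
    intro D hDm hD0
    refine hki.integral_prod_left.mono'
      (measurable_setIntegral_Ioc_left hkm hDm).aestronglyMeasurable (ae_of_all _ fun ω => ?_)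
    rw [Real.norm_of_nonneg (setIntegral_nonneg measurableSet_Ioc fun b _ => hk0 ω b)]
    exact setIntegral_Ioc_antitoneOn (hks ω) (hk0 ω) self_mem_Ici (hD0 ω) (hD0 ω)
  have hi₁ := hint D₁ hD₁ fun ω => (hD ω).1
  have hi₂ := hint D₂ hD₂ fun ω => (hD ω).1.trans (hD ω).2.1
  have main : ∀ (α : ℝ) (A₁ A₂ : Ω → ℝ), α ∈ Ioo (0 : ℝ) 1 → Measurable A₁ → Measurable A₂ →
      (∀ ω, 0 ≤ A₁ ω ∧ A₁ ω ≤ A₂ ω ∧ A₂ ω ≤ c) →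
      (∀ ω, IsMaxOn (lagrangian c (ψ ω) (k ω) r) (Icc 0 c) (A₁ ω)) →
      (∀ ω, IsMaxOn (lagrangian c (ψ ω) (k ω) r) (Icc 0 c) (A₂ ω)) →
      α * (∫ ω, (∫ b in Ioc (A₁ ω) c, k ω b) ∂μ) +
        (1 - α) * (∫ ω, (∫ b in Ioc (A₂ ω) c, k ω b) ∂μ) = R →
      ∃ (α : ℝ) (D₁ D₂ : Ω → ℝ), α ∈ Ioo (0 : ℝ) 1 ∧ Measurable D₁ ∧ Measurable D₂ ∧
      (∀ ω, 0 ≤ D₁ ω ∧ D₁ ω ≤ D₂ ω ∧ D₂ ω ≤ c) ∧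
      ∫ z, tiers α (D₁ z.1) (D₂ z.1) z.2 * Function.uncurry k z
        ∂μ.prod (volume.restrict (Ioc 0 c)) = R ∧
      ∀ y, IsMonotoneAllocation μ c y →
        ∫ z, Function.uncurry y z * Function.uncurry k z
          ∂μ.prod (volume.restrict (Ioc 0 c)) = R →
        ∫ z, Function.uncurry y z * Function.uncurry ψ z
          ∂μ.prod (volume.restrict (Ioc 0 c)) ≤
        ∫ z, tiers α (D₁ z.1) (D₂ z.1) z.2 * Function.uncurry ψ z
          ∂μ.prod (volume.restrict (Ioc 0 c)) := by
    intro α A₁ A₂ hα hA₁ hA₂ hA hmA₁ hmA₂ hmix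
    have hval : ∫ z, tiers α (A₁ z.1) (A₂ z.1) z.2 * Function.uncurry k z
        ∂μ.prod (volume.restrict (Ioc 0 c)) = R := by
      rw [integral_tiers_mul hα hA₁ hA₂ (fun ω => (hA ω).1) (fun ω => (hA ω).2.1) hks hki,
        integral_add ((hint _ hA₁ fun ω => (hA ω).1).const_mul α)
          ((hint _ hA₂ fun ω => (hA ω).1.trans (hA ω).2.1).const_mul (1 - α)),
        integral_const_mul, integral_const_mul, hmix]
    exact ⟨α, A₁, A₂, hα, hA₁, hA₂, hA, hval, fun y hy heq =>
      integral_mul_le_of_isMaxOn hc hα hA₁ hA₂ hA hψs hks hψi hki hmA₁ hmA₂ hy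
        (heq.trans hval.symm)⟩
  -- If one threshold policy already meets the constraint, the mixing weight would be `0` or `1`.
  -- That policy is used twice instead, which leaves the weight free, here `1 / 2`.
  rcases hle.eq_or_lt with h2 | h2
  · exact main (1 / 2) D₂ D₂ hhalf hD₂ hD₂
      (fun ω => ⟨(hD ω).1.trans (hD ω).2.1, le_rfl, (hD ω).2.2⟩) hm₂ hm₂ (by rw [h2]; ring)
  rcases hge.eq_or_lt with h1 | h1
  · exact main (1 / 2) D₁ D₁ hhalf hD₁ hD₁
      (fun ω => ⟨(hD ω).1, le_rfl, (hD ω).2.1.trans (hD ω).2.2⟩) hm₁ hm₁ (by rw [← h1]; ring)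
  set q₁ := ∫ ω, (∫ b in Ioc (D₁ ω) c, k ω b) ∂μ
  set q₂ := ∫ ω, (∫ b in Ioc (D₂ ω) c, k ω b) ∂μ
  have hpos : 0 < q₁ - q₂ := by linarith
  -- This weight solves `α * q₁ + (1 - α) * q₂ = R`.
  refine main ((R - q₂) / (q₁ - q₂)) D₁ D₂
    ⟨div_pos (by linarith) hpos, (div_lt_one hpos).2 (by linarith)⟩ hD₁ hD₂ hD hm₁ hm₂ ?_
  change (R - q₂) / (q₁ - q₂) * q₁ + (1 - (R - q₂) / (q₁ - q₂)) * q₂ = R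
  field_simp
  ring

/-- A linear objective over monotone allocations subject to one linear constraint is maximized by
an allocation with at most one intermediate coverage, which is common to all `ω`. -/
theorem exists_optimal_tiers {μ : Measure Ω} [SFinite μ] {c : ℝ} (hc : 0 < c)
    {ψ k : Ω × ℝ → ℝ}
    (hψi : Integrable ψ (μ.prod (volume.restrict (Ioc 0 c))))
    (hki : Integrable k (μ.prod (volume.restrict (Ioc 0 c))))
    (hkpos : ∀ᵐ z ∂μ.prod (volume.restrict (Ioc 0 c)), 0 < k z)
    {R : ℝ} (hR0 : 0 ≤ R) (hR1 : R ≤ ∫ z, k z ∂μ.prod (volume.restrict (Ioc 0 c))) :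
    ∃ (α : ℝ) (D₁ D₂ : Ω → ℝ), α ∈ Ioo (0 : ℝ) 1 ∧ Measurable D₁ ∧ Measurable D₂ ∧
      (∀ ω, 0 ≤ D₁ ω ∧ D₁ ω ≤ D₂ ω ∧ D₂ ω ≤ c) ∧
      ∫ z, tiers α (D₁ z.1) (D₂ z.1) z.2 * k z ∂μ.prod (volume.restrict (Ioc 0 c)) = R ∧
      ∀ y, IsMonotoneAllocation μ c y →
        ∫ z, Function.uncurry y z * k z ∂μ.prod (volume.restrict (Ioc 0 c)) = R →
        ∫ z, Function.uncurry y z * ψ z ∂μ.prod (volume.restrict (Ioc 0 c)) ≤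
        ∫ z, tiers α (D₁ z.1) (D₂ z.1) z.2 * ψ z ∂μ.prod (volume.restrict (Ioc 0 c)) := by
  set ν := volume.restrict (Ioc 0 c) with hν
  let ψ₀ := hψi.1.mk ψ
  let k₀ := hki.1.mk k
  have hψ₀m : Measurable ψ₀ := hψi.1.stronglyMeasurable_mk.measurable
  have hk₀m : Measurable k₀ := hki.1.stronglyMeasurable_mk.measurable
  have hψ₀ : ψ =ᵐ[μ.prod ν] ψ₀ := hψi.1.ae_eq_mk
  have hk₀ : k =ᵐ[μ.prod ν] k₀ := hki.1.ae_eq_mk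
  have hgood : ∀ᵐ ω ∂μ, Integrable (fun b => ψ₀ (ω, b)) ν ∧ Integrable (fun b => k₀ (ω, b)) ν :=
    (hψi.congr hψ₀).prod_right_ae.and (hki.congr hk₀).prod_right_ae
  obtain ⟨N, hNsub, hNm, hN0⟩ := exists_measurable_superset_of_null (ae_iff.1 hgood)
  have hgood' : ∀ ω ∉ N, Integrable (fun b => ψ₀ (ω, b)) ν ∧ Integrable (fun b => k₀ (ω, b)) ν := by
    intro ω hω
    by_contra hcon
    exact hω (hNsub hcon)
  have hNae : ∀ᵐ z ∂μ.prod ν, z.1 ∉ N :=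
    Measure.quasiMeasurePreserving_fst.ae (measure_eq_zero_iff_ae_notMem.1 hN0)
  classical
  -- Measurable representatives are set to zero on a null set of `ω` containing those with
  -- non-integrable sections, and `k` is truncated at zero, so that the requirements hold for every
  -- `ω` and not just almost every one.
  let ψ₁ : Ω → ℝ → ℝ := fun ω b => if ω ∈ N then 0 else ψ₀ (ω, b)
  let k₁ : Ω → ℝ → ℝ := fun ω b => if ω ∈ N then 0 else max (k₀ (ω, b)) 0
  have hψ₁ : ψ =ᵐ[μ.prod ν] Function.uncurry ψ₁ := by
    filter_upwards [hψ₀, hNae] with z hz hzN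
    simp [Function.uncurry, ψ₁, hzN, hz]
  have hk₁ : k =ᵐ[μ.prod ν] Function.uncurry k₁ := by
    filter_upwards [hk₀, hNae, hkpos] with z hz hzN hpos
    rw [hz] at hpos
    simp [Function.uncurry, k₁, hzN, hz, hpos.le]
  have hNset : MeasurableSet {z : Ω × ℝ | z.1 ∈ N} := measurable_fst hNm
  have hψ₁m : Measurable (Function.uncurry ψ₁) := Measurable.ite hNset measurable_const hψ₀m
  have hk₁m : Measurable (Function.uncurry k₁) :=
    Measurable.ite hNset measurable_const (hk₀m.max measurable_const)
  have hψs : ∀ ω, IntegrableOn (ψ₁ ω) (Ioc 0 c) := by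
    intro ω
    by_cases h : ω ∈ N
    · simp only [ψ₁, h, if_true]; exact integrableOn_zero
    · simp only [ψ₁, h, if_false]; exact (hgood' ω h).1
  have hks : ∀ ω, IntegrableOn (k₁ ω) (Ioc 0 c) := by
    intro ω
    by_cases h : ω ∈ N
    · simp only [k₁, h, if_true]; exact integrableOn_zero
    · simp only [k₁, h, if_false]; exact (hgood' ω h).2.pos_part
  have hk0 : ∀ ω b, 0 ≤ k₁ ω b := by
    intro ω b
    simp only [k₁]
    split_ifs
    · exact le_rfl
    · exact le_max_right _ _
  have hcongr : ∀ {v w w' : Ω × ℝ → ℝ}, w =ᵐ[μ.prod ν] w' →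
      ∫ z, v z * w z ∂μ.prod ν = ∫ z, v z * w' z ∂μ.prod ν := by
    intro v w w' h
    refine integral_congr_ae ?_
    filter_upwards [h] with z hz
    rw [hz]
  obtain ⟨α, D₁, D₂, hα, hD₁, hD₂, hD, hval, hopt⟩ :=
    exists_optimal_tiers_of_measurable (R := R) hc hψ₁m hk₁m hψs hks hk0 (hψi.congr hψ₁)
      (hki.congr hk₁) (by filter_upwards [hkpos, hk₁] with z hz hz'; rwa [← hz']) hR0
      (by rwa [← integral_congr_ae hk₁])
  refine ⟨α, D₁, D₂, hα, hD₁, hD₂, hD, (hcongr hk₁).trans hval, fun y hy heq => ?_⟩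
  rw [hcongr hψ₁, hcongr hψ₁]
  exact hopt y hy ((hcongr hk₁).symm.trans heq)

end Allocations

/-! ### Measurability from regularity on the domain only -/

theorem aemeasurable_prod_restrict {s t : Set ℝ} (hs : MeasurableSet s) (ht : MeasurableSet t)
    {k : ℝ × ℝ → ℝ} (h : Measurable fun z : s × t => k (z.1, z.2)) :
    AEMeasurable k ((volume.restrict s).prod (volume.restrict t)) := by
  have he : MeasurableEmbedding (Prod.map ((↑) : s → ℝ) ((↑) : t → ℝ)) :=
    (MeasurableEmbedding.subtype_coe hs).prodMap (MeasurableEmbedding.subtype_coe ht)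
  refine ⟨Function.extend (Prod.map ((↑) : s → ℝ) ((↑) : t → ℝ)) (fun z => k (z.1, z.2)) 0,
    he.measurable_extend h measurable_zero, ?_⟩
  rw [Measure.prod_restrict]
  filter_upwards [ae_restrict_mem (hs.prod ht)] with z hz
  exact (he.injective.extend_apply (fun z : s × t => k (z.1, z.2)) 0 (⟨z.1, hz.1⟩, ⟨z.2, hz.2⟩)).symm

/-- Carathéodory functions are jointly measurable; separate continuity is more than enough. -/
theorem measurable_of_continuousOn_sections {s t : Set ℝ} {k : ℝ → ℝ → ℝ}
    (h₁ : ∀ b ∈ t, ContinuousOn (fun θ => k θ b) s) (h₂ : ∀ θ ∈ s, ContinuousOn (k θ) t) :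
    Measurable fun z : s × t => k z.1 z.2 :=
  measurable_uncurry_of_continuous_of_measurable (u := fun (θ : s) (b : t) => k θ b)
    (fun b => (h₁ b b.2).domRestrict) fun θ => (h₂ θ θ.2).domRestrict.measurable

/-! ### Truncation at the top of the support and regularity of the valuation distributions -/

namespace InsuranceModel

variable (E : InsuranceModel)

/-- The number `c` is the minimum of `p` and `b̄`. The primitives are regular on `(0, c)`, and
valuations between `c` and `p` carry no density. -/
theorem exists_truncation {p : ℝ} (hp : 0 < p) :
    ∃ c : ℝ, 0 < c ∧ c ≤ p ∧ (c : EReal) ≤ E.bbar ∧ (c = p ∨ (c : EReal) = E.bbar) := by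
  rcases le_total (p : EReal) E.bbar with h | h
  · exact ⟨p, hp, le_rfl, h, Or.inl rfl⟩
  · have hcoe : ((E.bbar.toReal : ℝ) : EReal) = E.bbar :=
      EReal.coe_toReal (fun ht => by simp [ht] at h)
        (fun hb => by simpa [hb] using E.bbar_pos)
    refine ⟨E.bbar.toReal, ?_, ?_, hcoe.le, Or.inr hcoe⟩
    · have := E.bbar_pos; rw [← hcoe] at this; exact_mod_cast this
    · rw [← hcoe] at h; exact_mod_cast h

variable {E} {θ c p : ℝ}

theorem mem_B_of_lt (hc : (c : EReal) ≤ E.bbar) {b : ℝ} (h0 : 0 ≤ b) (hb : b < c) : b ∈ E.B :=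
  ⟨h0, (EReal.coe_lt_coe_iff.2 hb).trans_le hc⟩

theorem B_mem_nhds (hc : (c : EReal) ≤ E.bbar) {b : ℝ} (hb : b ∈ Ioo 0 c) : E.B ∈ 𝓝 b :=
  mem_of_superset (Ioo_mem_nhds hb.1 hb.2) fun _ hx => mem_B_of_lt hc hx.1.le hx.2

theorem convex_B : Convex ℝ E.B := by
  refine OrdConnected.convex ⟨fun x hx y hy z hz => ⟨hx.1.trans hz.1, ?_⟩⟩
  exact (EReal.coe_le_coe_iff.2 hz.2).trans_lt hy.2

theorem continuousOn_H_B (hθ : θ ∈ E.Θ) : ContinuousOn (E.H θ) E.B :=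
  (E.H_contDiffOn_valuation θ hθ).continuousOn

theorem hasDerivAt_H (hθ : θ ∈ E.Θ) (hc : (c : EReal) ≤ E.bbar) {b : ℝ} (hb : b ∈ Ioo 0 c) :
    HasDerivAt (E.H θ) (E.h θ b) b :=
  (((E.H_contDiffOn_valuation θ hθ).differentiableOn one_ne_zero b
    (mem_B_of_lt hc hb.1.le hb.2)).hasDerivWithinAt).hasDerivAt (B_mem_nhds hc hb)

theorem monotoneOn_H_B (hθ : θ ∈ E.Θ) : MonotoneOn (E.H θ) E.B := by
  refine (strictMonoOn_of_deriv_pos convex_B (continuousOn_H_B hθ) fun b hb => ?_).monotoneOn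
  rw [← derivWithin_of_mem_nhds (mem_interior_iff_mem_nhds.1 hb)]
  have hb' : b ∈ E.B := interior_subset hb
  exact E.H_density_pos θ hθ b hb'.1 hb'.2

theorem H_mem_Icc (hθ : θ ∈ E.Θ) {b : ℝ} (hb : 0 ≤ b) : E.H θ b ∈ Icc (0 : ℝ) 1 := by
  rcases lt_or_ge (b : EReal) E.bbar with h | h
  · exact E.H_mem θ hθ b hb h
  · rw [E.H_eq_one θ hθ b h]; simp

theorem monotoneOn_H (hθ : θ ∈ E.Θ) : MonotoneOn (E.H θ) (Ici 0) := by
  intro a ha b hb hab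
  rcases lt_or_ge (b : EReal) E.bbar with h | h
  · exact monotoneOn_H_B hθ ⟨ha, (EReal.coe_le_coe_iff.2 hab).trans_lt h⟩ ⟨hb, h⟩ hab
  · rw [E.H_eq_one θ hθ b h]
    exact (H_mem_Icc hθ ha).2

theorem continuousOn_H (hθ : θ ∈ E.Θ) (hc : (c : EReal) ≤ E.bbar) :
    ContinuousOn (E.H θ) (Icc 0 c) := by
  rcases hc.lt_or_eq with h | h
  · exact (continuousOn_H_B hθ).mono fun b hb =>
      ⟨hb.1, (EReal.coe_le_coe_iff.2 hb.2).trans_lt h⟩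
  intro b hb
  rcases hb.2.lt_or_eq with hlt | rfl
  · refine ((continuousOn_H_B hθ) b (mem_B_of_lt hc hb.1 hlt)).mono_of_mem_nhdsWithin ?_
    refine mem_nhdsWithin.2 ⟨Iio c, isOpen_Iio, hlt, fun x hx => mem_B_of_lt hc hx.2.1 hx.1⟩
  -- At the endpoint `b = b̄` continuity is not part of smoothness on `B`. It follows from
  -- monotonicity and the supremum of `H θ` over `B` being `1`.
  · have h1 : E.H θ b = 1 := E.H_eq_one θ hθ b h.ge
    rw [ContinuousWithinAt, h1]
    refine tendsto_order.2 ⟨fun a ha => ?_, fun a ha => ?_⟩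
    · obtain ⟨_, ⟨x, hx, rfl⟩, hax⟩ := (lt_isLUB_iff (E.H_isLUB θ hθ)).1 ha
      have hxb : x < b := by
        have := hx.2; rw [← h] at this; exact_mod_cast this
      filter_upwards [self_mem_nhdsWithin, mem_nhdsWithin_of_mem_nhds (Ioi_mem_nhds hxb)]
        with z hz hxz
      exact hax.trans_le (monotoneOn_H hθ hx.1 hz.1 (le_of_lt hxz))
    · filter_upwards [self_mem_nhdsWithin] with z hz
      exact (H_mem_Icc hθ hz.1).2.trans_lt ha

theorem h_pos (hθ : θ ∈ E.Θ) (hc : (c : EReal) ≤ E.bbar) {b : ℝ} (hb : b ∈ Ioo 0 c) :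
    0 < E.h θ b :=
  E.H_density_pos θ hθ b hb.1.le (mem_B_of_lt hc hb.1.le hb.2).2

/-- The density may be unbounded near `b̄`; it is integrable as the non-negative derivative of a
function continuous up to the endpoint. -/
theorem integrableOn_h (hθ : θ ∈ E.Θ) (hc : (c : EReal) ≤ E.bbar) :
    IntegrableOn (E.h θ) (Ioc 0 c) :=
  intervalIntegral.integrableOn_deriv_of_nonneg (continuousOn_H hθ hc)
    (fun _ hb => hasDerivAt_H hθ hc hb) fun _ hb => (h_pos hθ hc hb).le

theorem setIntegral_h (hθ : θ ∈ E.Θ) (hc0 : 0 ≤ c) (hc : (c : EReal) ≤ E.bbar) :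
    ∫ b in Ioc 0 c, E.h θ b = E.H θ c - E.H θ 0 := by
  rw [← intervalIntegral.integral_of_le hc0]
  exact intervalIntegral.integral_eq_sub_of_hasDerivAt_of_le hc0 (continuousOn_H hθ hc)
    (fun _ hb => hasDerivAt_H hθ hc hb)
    ((intervalIntegrable_iff_integrableOn_Ioc_of_le hc0).2 (integrableOn_h hθ hc))

theorem H_truncation (hθ : θ ∈ E.Θ) (hcp : c ≤ p) (h : c = p ∨ (c : EReal) = E.bbar) :
    E.H θ c = E.H θ p := by
  rcases h with rfl | h
  · rfl
  · rw [E.H_eq_one θ hθ c h.ge, E.H_eq_one θ hθ p (h.ge.trans (EReal.coe_le_coe_iff.2 hcp))]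

/-- Outside the closure of `B` the derivative within `B` takes its default value zero. -/
theorem h_eq_zero {b : ℝ} (hcb : c < b) (h : (c : EReal) = E.bbar) : E.h θ b = 0 := by
  refine derivWithin_zero_of_notMem_closure fun hb => ?_
  have hsub : E.B ⊆ Iic c := fun x hx => by
    have := hx.2; rw [← h] at this; exact (by exact_mod_cast this : x < c).le
  exact hcb.not_ge (closure_minimal hsub isClosed_Iic hb)

theorem integral_mul_h (hc0 : 0 < c) (hcp : c ≤ p) (h : c = p ∨ (c : EReal) = E.bbar)
    (v : ℝ → ℝ) : ∫ b in (0 : ℝ)..p, v b * E.h θ b = ∫ b in Ioc 0 c, v b * E.h θ b := by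
  rw [intervalIntegral.integral_of_le (hc0.le.trans hcp)]
  refine setIntegral_eq_of_subset_of_forall_sdiff_eq_zero measurableSet_Ioc
    (Ioc_subset_Ioc_right hcp) fun b hb => ?_
  have hcb : c < b := by
    by_contra! hle
    exact hb.2 ⟨hb.1.1, hle⟩
  rcases h with rfl | h
  · exact absurd hb.1.2 hcb.not_ge
  · rw [h_eq_zero hcb h, mul_zero]

theorem continuousOn_H_type {b : ℝ} (hb : 0 ≤ b) : ContinuousOn (fun θ => E.H θ b) E.Θ := by
  rcases lt_or_ge (b : EReal) E.bbar with h | h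
  · exact (E.H_contDiffOn_type b hb h).continuousOn
  · exact continuousOn_const.congr fun θ hθ => E.H_eq_one θ hθ b h

theorem measurable_H (hc : (c : EReal) ≤ E.bbar) :
    Measurable fun z : E.Θ × Ioo 0 c => E.H z.1 z.2 :=
  measurable_of_continuousOn_sections (fun _ hb => continuousOn_H_type hb.1.le)
    fun _ hθ => (continuousOn_H hθ hc).mono Ioo_subset_Icc_self

theorem continuousOn_dH {b : ℝ} (hb : b ∈ E.B) : ContinuousOn (fun θ => E.dH θ b) E.Θ :=
  (E.H_contDiffOn_type b hb.1 hb.2).continuousOn_derivWithin (uniqueDiffOn_Icc E.θlo_lt_θhi) le_rfl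

theorem measurable_dH (hc : (c : EReal) ≤ E.bbar) :
    Measurable fun z : E.Θ × Ioo 0 c => E.dH z.1 z.2 :=
  measurable_of_continuousOn_sections
    (fun _ hb => continuousOn_dH (mem_B_of_lt hc hb.1.le hb.2)) fun θ hθ =>
      (E.H_cross_exists θ hθ).continuousOn.mono fun _ hb => mem_B_of_lt hc hb.1.le hb.2

theorem measurable_h (hc : (c : EReal) ≤ E.bbar) :
    Measurable fun z : E.Θ × Ioo 0 c => E.h z.1 z.2 := by
  -- `h` is the pointwise limit of difference quotients of `H`. Step sizes proportional to `c - b`,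
  -- with factor less than `1`, keep the shifted point inside `(0, c)`.
  let ε : ℕ → E.Θ × Ioo 0 c → ℝ := fun n z => (c - z.2) * (1 / ((n : ℝ) + 1 + 1))
  have hε : ∀ n z, 0 < ε n z ∧ ε n z < c - z.2 := by
    intro n z
    have h1 : 0 < c - (z.2 : ℝ) := sub_pos.2 z.2.2.2
    have h2 : 1 / ((n : ℝ) + 1 + 1) < 1 := by
      rw [div_lt_one (by positivity)]
      have : (0 : ℝ) ≤ n := n.cast_nonneg
      linarith
    exact ⟨mul_pos h1 (by positivity), mul_lt_of_lt_one_right h1 h2⟩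
  have hεm : ∀ n, Measurable (ε n) := fun n => by fun_prop
  have hmem : ∀ n z, (z.2 : ℝ) + ε n z ∈ Ioo 0 c := fun n z =>
    ⟨add_pos z.2.2.1 (hε n z).1, by linarith [(hε n z).2]⟩
  have hH : ∀ n, Measurable fun z : E.Θ × Ioo 0 c => E.H z.1 (z.2 + ε n z) := fun n =>
    (measurable_H hc).comp (g := fun z : E.Θ × Ioo 0 c => E.H z.1 z.2)
      (f := fun z : E.Θ × Ioo 0 c => (z.1, (⟨z.2 + ε n z, hmem n z⟩ : Ioo 0 c)))
      (measurable_fst.prodMk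
        (((measurable_subtype_coe.comp measurable_snd).add (hεm n)).subtype_mk))
  refine measurable_of_tendsto_metrizable
    (f := fun n (z : E.Θ × Ioo 0 c) => (ε n z)⁻¹ * (E.H z.1 (z.2 + ε n z) - E.H z.1 z.2))
    (fun n => (hεm n).inv.mul ((hH n).sub (measurable_H hc))) (tendsto_pi_nhds.2 fun z => ?_)
  have hlim : Tendsto (fun n => ε n z) atTop (𝓝[>] 0) := by
    refine tendsto_nhdsWithin_iff.2 ⟨?_, Eventually.of_forall fun n => (hε n z).1⟩
    have h1 := (tendsto_one_div_add_atTop_nhds_zero_nat (𝕜 := ℝ)).comp (tendsto_add_atTop_nat 1)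
    simpa [ε, Function.comp_def] using h1.const_mul (c - (z.2 : ℝ))
  simpa only [smul_eq_mul, Function.comp_def] using
    (hasDerivAt_H z.1.2 hc z.2.2).tendsto_slope_zero_right.comp hlim

/-! ### Integrability of the demand density and of the weighted virtual value -/

/-- Lebesgue measure on the types times Lebesgue measure on the valuations in `(0, c]`. -/
abbrev lebesgue (E : InsuranceModel) (c : ℝ) : Measure (ℝ × ℝ) :=
  (volume.restrict E.Θ).prod (volume.restrict (Ioc 0 c))

theorem measurableSet_Θ : MeasurableSet E.Θ := measurableSet_Icc

instance isFiniteMeasure_restrict_Θ : IsFiniteMeasure (volume.restrict E.Θ) := by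
  unfold Θ; infer_instance

theorem restrict_Ioc_eq (c : ℝ) : (volume.restrict (Ioc 0 c) : Measure ℝ) =
    volume.restrict (Ioo 0 c) := Measure.restrict_congr_set Ioo_ae_eq_Ioc.symm

theorem ae_lebesgue : ∀ᵐ z ∂E.lebesgue c, z.1 ∈ E.Θ ∧ z.2 ∈ Ioo 0 c := by
  rw [lebesgue, restrict_Ioc_eq, Measure.prod_restrict]
  exact ae_restrict_mem (measurableSet_Θ.prod measurableSet_Ioo)

theorem aestronglyMeasurable_lebesgue {k : ℝ × ℝ → ℝ}
    (h : Measurable fun z : E.Θ × Ioo 0 c => k (z.1, z.2)) :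
    AEStronglyMeasurable k (E.lebesgue c) := by
  rw [lebesgue, restrict_Ioc_eq]
  exact (aemeasurable_prod_restrict measurableSet_Θ measurableSet_Ioo h).aestronglyMeasurable

theorem integrable_h (hc0 : 0 ≤ c) (hc : (c : EReal) ≤ E.bbar) :
    Integrable (fun z : ℝ × ℝ => E.h z.1 z.2) (E.lebesgue c) := by
  have hm : AEStronglyMeasurable (fun z : ℝ × ℝ => E.h z.1 z.2) (E.lebesgue c) :=
    aestronglyMeasurable_lebesgue (measurable_h hc)
  refine (integrable_prod_iff hm).2 ⟨?_, ?_⟩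
  · filter_upwards [ae_restrict_mem measurableSet_Θ] with θ hθ using integrableOn_h hθ hc
  · refine Integrable.of_bound (C := 1) (μ := volume.restrict E.Θ) hm.norm.integral_prod_right' ?_
    filter_upwards [ae_restrict_mem measurableSet_Θ] with θ hθ
    have h1 : ∫ b in Ioc 0 c, ‖E.h θ b‖ = ∫ b in Ioc 0 c, E.h θ b := by
      rw [restrict_Ioc_eq]
      exact setIntegral_congr_fun measurableSet_Ioo fun b hb =>
        Real.norm_of_nonneg (h_pos hθ hc hb).le
    have h2 := H_mem_Icc hθ hc0
    have h3 := H_mem_Icc hθ le_rfl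
    have h4 := monotoneOn_H hθ self_mem_Ici hc0 hc0
    simp only [h1]
    rw [setIntegral_h hθ hc0 hc, Real.norm_of_nonneg (sub_nonneg.2 h4)]
    linarith [h2.2, h3.1]

/-- Stochastic dominance fixes the sign of `dH`, so its absolute value integrates over types to `H
θlo b - H θhi b`. The bound is uniform in `b`, though `dH` itself need not be bounded near `b̄`. -/
theorem setIntegral_norm_dH_le {b : ℝ} (hb : b ∈ E.B) : ∫ θ in E.Θ, ‖E.dH θ b‖ ≤ 1 := by
  have hle := E.θlo_lt_θhi.le
  have hanti := E.H_fosd b hb.1 hb.2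
  have hcd := E.H_contDiffOn_type b hb.1 hb.2
  have h1 : ∫ θ in E.θlo..E.θhi, E.dH θ b = E.H E.θhi b - E.H E.θlo b := by
    refine intervalIntegral.integral_eq_sub_of_hasDerivAt_of_le hle hcd.continuousOn
      (fun θ hθ => ?_) ?_
    · exact (hcd.differentiableOn one_ne_zero θ (Ioo_subset_Icc_self hθ)).hasDerivWithinAt.hasDerivAt
        (Icc_mem_nhds hθ.1 hθ.2)
    · refine ContinuousOn.intervalIntegrable ?_
      rw [uIcc_of_le hle]
      exact continuousOn_dH hb
  have h2 : ∫ θ in E.Θ, ‖E.dH θ b‖ = -∫ θ in E.θlo..E.θhi, E.dH θ b := by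
    rw [intervalIntegral.integral_of_le hle, ← integral_neg, Θ, integral_Icc_eq_integral_Ioc]
    exact integral_congr_ae (ae_of_all _ fun θ => by
      simp only [dH]
      exact Real.norm_of_nonpos (AntitoneOn.derivWithin_nonpos hanti))
  rw [h2, h1]
  have h3 := H_mem_Icc (left_mem_Icc.2 hle : E.θlo ∈ E.Θ) hb.1
  have h4 := H_mem_Icc (right_mem_Icc.2 hle : E.θhi ∈ E.Θ) hb.1
  linarith [h3.2, h4.1]

theorem integrable_dH (hc : (c : EReal) ≤ E.bbar) :
    Integrable (fun z : ℝ × ℝ => E.dH z.1 z.2) (E.lebesgue c) := by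
  have hm : AEStronglyMeasurable (fun z : ℝ × ℝ => E.dH z.1 z.2) (E.lebesgue c) :=
    aestronglyMeasurable_lebesgue (measurable_dH hc)
  have hmem : ∀ᵐ b ∂volume.restrict (Ioc 0 c), b ∈ E.B := by
    rw [restrict_Ioc_eq]
    filter_upwards [ae_restrict_mem measurableSet_Ioo] with b hb using mem_B_of_lt hc hb.1.le hb.2
  refine (integrable_prod_iff' hm).2 ⟨?_, ?_⟩
  · filter_upwards [hmem] with b hb using (continuousOn_dH hb).integrableOn_Icc
  · refine Integrable.of_bound (C := 1) (μ := volume.restrict (Ioc 0 c))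
      hm.norm.prod_swap.integral_prod_right' ?_
    filter_upwards [hmem] with b hb
    rw [Real.norm_of_nonneg (integral_nonneg fun _ => norm_nonneg _)]
    exact setIntegral_norm_dH_le hb

theorem continuousOn_inverseHazard : ContinuousOn (fun θ => (1 - E.F θ) / E.f θ) E.Θ := by
  have hF : ContinuousOn E.F E.Θ := by
    have hi : IntegrableOn E.f (uIcc E.θlo E.θhi) := by
      rw [uIcc_of_le E.θlo_lt_θhi.le]; exact E.f_continuousOn.integrableOn_Icc
    have := intervalIntegral.continuousOn_primitive_interval hi
    rwa [uIcc_of_le E.θlo_lt_θhi.le] at this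
  exact (continuousOn_const.sub hF).div E.f_continuousOn fun θ hθ => (E.f_pos θ hθ).ne'

theorem continuousOn_dg : ContinuousOn E.dg (Icc 0 1) :=
  E.g_contDiffOn.continuousOn_derivWithin (uniqueDiffOn_Icc zero_lt_one) le_rfl

theorem measurable_comp_H (hc : (c : EReal) ≤ E.bbar) {φ : ℝ → ℝ}
    (hφ : ContinuousOn φ (Icc 0 1)) : Measurable fun z : E.Θ × Ioo 0 c => φ (E.H z.1 z.2) :=
  hφ.domRestrict.measurable.comp
    ((measurable_H hc).subtype_mk (h := fun z => H_mem_Icc z.1.2 z.2.2.1.le))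

theorem measurable_type {φ : ℝ → ℝ} (hφ : ContinuousOn φ E.Θ) :
    Measurable fun z : E.Θ × Ioo 0 c => φ z.1 :=
  hφ.domRestrict.measurable.comp measurable_fst

theorem integrable_h_mul_f (hc0 : 0 ≤ c) (hc : (c : EReal) ≤ E.bbar) :
    Integrable (fun z : ℝ × ℝ => E.h z.1 z.2 * E.f z.1) (E.lebesgue c) := by
  obtain ⟨C, hC⟩ := isCompact_Icc.exists_bound_of_continuousOn E.f_continuousOn
  refine ((integrable_h hc0 hc).bdd_mul (c := C) (f := fun z => E.f z.1)
    (aestronglyMeasurable_lebesgue (measurable_type E.f_continuousOn)) ?_).congr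
    (ae_of_all _ fun z => mul_comm _ _)
  filter_upwards [ae_lebesgue] with z hz using hC _ hz.1

/-- Multiplication by the density removes every division by `h`. What is left is a bounded term, a
bounded multiple of `dH` and a bounded multiple of `h`, which gives integrability. -/
theorem J_mul_h {b : ℝ} (hh : E.h θ b ≠ 0) :
    E.J p θ b * E.h θ b = (E.H θ b - E.g (E.H θ b)) +
      (1 - E.F θ) / E.f θ * E.dg (E.H θ b) * E.dH θ b + (b - p) * E.h θ b := by
  unfold J
  -- The inverse hazard rate stays opaque, so that only the denominator `h` is cleared.
  generalize (1 - E.F θ) / E.f θ = a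
  field_simp
  ring

theorem integrable_J_mul_h_mul_f (p : ℝ) (hc0 : 0 ≤ c) (hc : (c : EReal) ≤ E.bbar) :
    Integrable (fun z : ℝ × ℝ => E.J p z.1 z.2 * E.h z.1 z.2 * E.f z.1) (E.lebesgue c) := by
  obtain ⟨Cf, hCf⟩ := isCompact_Icc.exists_bound_of_continuousOn E.f_continuousOn
  obtain ⟨Ca, hCa⟩ := isCompact_Icc.exists_bound_of_continuousOn E.continuousOn_inverseHazard
  obtain ⟨Cg, hCg⟩ := isCompact_Icc.exists_bound_of_continuousOn E.continuousOn_dg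
  have hmulf : ∀ {w : ℝ × ℝ → ℝ}, Integrable w (E.lebesgue c) →
      Integrable (fun z => E.f z.1 * w z) (E.lebesgue c) := by
    intro w hw
    refine hw.bdd_mul (c := Cf)
      (aestronglyMeasurable_lebesgue (measurable_type E.f_continuousOn)) ?_
    filter_upwards [ae_lebesgue] with z hz using hCf _ hz.1
  have h1 : Integrable (fun z : ℝ × ℝ => E.H z.1 z.2 - E.g (E.H z.1 z.2)) (E.lebesgue c) := by
    refine Integrable.of_bound (C := 1) (aestronglyMeasurable_lebesgue
      ((measurable_H hc).sub (measurable_comp_H hc E.g_contDiffOn.continuousOn))) ?_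
    filter_upwards [ae_lebesgue] with z hz
    have hH := H_mem_Icc hz.1 hz.2.1.le
    have hg := E.g_mem _ hH
    rw [Real.norm_eq_abs, abs_le]
    constructor <;> linarith [hH.1, hH.2, hg.1, hg.2]
  have h2 : Integrable (fun z : ℝ × ℝ =>
      (1 - E.F z.1) / E.f z.1 * E.dg (E.H z.1 z.2) * E.dH z.1 z.2) (E.lebesgue c) := by
    refine (integrable_dH hc).bdd_mul (c := Ca * Cg) (aestronglyMeasurable_lebesgue
      ((measurable_type E.continuousOn_inverseHazard).mul
        (measurable_comp_H hc E.continuousOn_dg))) ?_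
    filter_upwards [ae_lebesgue] with z hz
    rw [norm_mul]
    exact mul_le_mul (hCa _ hz.1) (hCg _ (H_mem_Icc hz.1 hz.2.1.le)) (norm_nonneg _)
      ((norm_nonneg _).trans (hCa _ hz.1))
  have h3 : Integrable (fun z : ℝ × ℝ => (z.2 - p) * E.h z.1 z.2) (E.lebesgue c) := by
    refine (integrable_h hc0 hc).bdd_mul (c := c + |p|)
      (measurable_snd.sub_const p).aestronglyMeasurable ?_
    filter_upwards [ae_lebesgue] with z hz
    refine (norm_sub_le _ _).trans (add_le_add ?_ le_rfl)
    rw [Real.norm_of_nonneg hz.2.1.le]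
    exact hz.2.2.le
  refine (hmulf ((h1.add h2).add h3)).congr ?_
  filter_upwards [ae_lebesgue] with z hz
  rw [J_mul_h (h_pos hz.1 hc hz.2).ne', mul_comm]
  rfl

/-! ### Translation of the first-stage problem to the product measure -/

theorem isMonotoneAllocation_of_isFeasible (hc : (c : EReal) ≤ E.bbar) {y : ℝ → ℝ → ℝ}
    (hy : E.IsFeasible p y) : IsMonotoneAllocation (volume.restrict E.Θ) c y where
  aemeasurable := by
    rw [restrict_Ioc_eq, Measure.prod_restrict]
    exact hy.aemeasurable.mono_measure (Measure.restrict_mono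
      (prod_mono le_rfl fun b hb => mem_B_of_lt hc hb.1.le hb.2) le_rfl)
  mono := by
    filter_upwards [ae_restrict_mem measurableSet_Θ] with θ hθ
    exact (hy.mono θ hθ).mono fun b hb => mem_B_of_lt hc hb.1.le hb.2
  mem_unit := by
    filter_upwards [ae_restrict_mem measurableSet_Θ] with θ hθ b hb
    exact hy.mem_unit θ hθ b (mem_B_of_lt hc hb.1.le hb.2)

theorem intervalIntegral_type (v : ℝ → ℝ) :
    ∫ θ in E.θlo..E.θhi, v θ = ∫ θ in E.Θ, v θ := by
  rw [intervalIntegral.integral_of_le E.θlo_lt_θhi.le, Θ, integral_Icc_eq_integral_Ioc]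

theorem iterated_integral_eq (hc0 : 0 < c) (hcp : c ≤ p) (h : c = p ∨ (c : EReal) = E.bbar)
    (v : ℝ → ℝ → ℝ)
    (hv : Integrable (fun z : ℝ × ℝ => v z.1 z.2 * E.h z.1 z.2 * E.f z.1) (E.lebesgue c)) :
    ∫ θ in E.θlo..E.θhi, (∫ b in (0 : ℝ)..p, v θ b * E.h θ b) * E.f θ =
      ∫ z, v z.1 z.2 * E.h z.1 z.2 * E.f z.1 ∂E.lebesgue c := by
  rw [intervalIntegral_type, lebesgue, integral_prod _ hv]
  refine integral_congr_ae (ae_of_all _ fun θ => ?_)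
  simp only [integral_mul_h hc0 hcp h]
  rw [integral_mul_const]

theorem coveredDemand_eq (hc0 : 0 < c) (hc : (c : EReal) ≤ E.bbar) (hcp : c ≤ p)
    (h : c = p ∨ (c : EReal) = E.bbar) {y : ℝ → ℝ → ℝ}
    (hy : IsMonotoneAllocation (volume.restrict E.Θ) c y) :
    E.coveredDemand p y =
      ∫ z, Function.uncurry y z * (E.h z.1 z.2 * E.f z.1) ∂E.lebesgue c := by
  rw [coveredDemand, iterated_integral_eq hc0 hcp h]
  · simp only [mul_assoc, Function.uncurry]
  · simpa only [mul_assoc, Function.uncurry] using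
      hy.integrable_mul (integrable_h_mul_f hc0.le hc)

theorem profit_eq (hc0 : 0 < c) (hc : (c : EReal) ≤ E.bbar) (hcp : c ≤ p)
    (h : c = p ∨ (c : EReal) = E.bbar) {y : ℝ → ℝ → ℝ}
    (hy : IsMonotoneAllocation (volume.restrict E.Θ) c y) :
    E.profit p y = (∫ z, Function.uncurry y z * (E.J p z.1 z.2 * E.h z.1 z.2 * E.f z.1)
      ∂E.lebesgue c) + E.K p := by
  rw [profit, iterated_integral_eq hc0 hcp h (fun θ b => y θ b * E.J p θ b)]
  · simp only [mul_assoc, Function.uncurry]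
  · simpa only [mul_assoc, Function.uncurry] using
      hy.integrable_mul (integrable_J_mul_h_mul_f p hc0.le hc)

theorem integrable_uncovered {b : ℝ} (hb : 0 ≤ b) :
    Integrable (fun θ => (1 - E.H θ b) * E.f θ) (volume.restrict E.Θ) :=
  ((continuousOn_const.sub (continuousOn_H_type hb)).mul E.f_continuousOn).integrableOn_Icc

theorem uncoveredDemand_anti {a b : ℝ} (ha : 0 ≤ a) (hab : a ≤ b) :
    E.uncoveredDemand b ≤ E.uncoveredDemand a := by
  rw [uncoveredDemand, uncoveredDemand, intervalIntegral_type, intervalIntegral_type]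
  refine setIntegral_mono_on (integrable_uncovered (ha.trans hab)) (integrable_uncovered ha)
    measurableSet_Θ fun θ hθ => ?_
  have h1 := monotoneOn_H hθ ha (ha.trans hab : b ∈ Ici 0) hab
  exact mul_le_mul_of_nonneg_right (by linarith) (E.f_pos θ hθ).le

/-- This is the largest demand that coverage can generate below `p`, hence the upper limit for the
residual supply. -/
theorem integral_h_mul_f (hc0 : 0 < c) (hc : (c : EReal) ≤ E.bbar) (hcp : c ≤ p)
    (h : c = p ∨ (c : EReal) = E.bbar) :
    ∫ z, E.h z.1 z.2 * E.f z.1 ∂E.lebesgue c = E.fullDemand - E.uncoveredDemand p := by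
  rw [lebesgue, integral_prod _ (integrable_h_mul_f hc0.le hc), fullDemand, uncoveredDemand,
    intervalIntegral_type, intervalIntegral_type, ← integral_sub (integrable_uncovered le_rfl)
    (integrable_uncovered (hc0.le.trans hcp))]
  refine setIntegral_congr_fun measurableSet_Θ fun θ hθ => ?_
  simp only
  rw [integral_mul_const, setIntegral_h hθ hc0.le hc, H_truncation hθ hcp h]
  ring

/-- Residual supply vanishes at `pN`; from there on supply rises and uncovered demand falls. -/
theorem RS_nonneg {pN : ℝ} (hN : E.IsNoCoveragePrice pN) (hp : pN ≤ p) : 0 ≤ E.RS p := by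
  have h1 := E.S_strictMonoOn.monotoneOn hN.1.le (hN.1.le.trans hp : p ∈ Ici 0) hp
  have h2 := uncoveredDemand_anti (E := E) hN.1.le hp
  have h3 := hN.2
  unfold RS
  linarith

theorem RS_le {pF : ℝ} (hF : E.IsFullCoveragePrice pF) (h0 : 0 ≤ p) (hp : p ≤ pF) :
    E.RS p ≤ E.fullDemand - E.uncoveredDemand p := by
  have h1 := E.S_strictMonoOn.monotoneOn h0 hF.1.le hp
  have h2 := hF.2
  unfold RS
  linarith

/-! ### Contracts that implement the two-tier allocations -/

theorem mem_optimalCoverages_of_isLeast {C : Set (ℝ × ℝ)} {b : ℝ} {a : ℝ × ℝ}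
    (ha : a ∈ insert (0, 0) C) (hle : ∀ a' ∈ insert (0, 0) C, itemLoss p b a ≤ itemLoss p b a') :
    a.1 ∈ optimalCoverages p C b := ⟨a, ⟨ha, hle⟩, rfl⟩

theorem induces_simple {α D : ℝ} (hD : D ≤ p) :
    E.Induces p {(1, D)} (tiers α D D) := by
  have hloss : ∀ b, itemLoss p b (0, 0) = min b p := fun b => by simp [itemLoss]
  have hloss' : ∀ b, itemLoss p b (1, D) = min D (min b p) := fun b => by simp [itemLoss]
  refine fun b hb => ⟨fun hbp => ?_, fun hbp => ⟨?_, ?_⟩⟩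
  · rcases lt_or_ge D b with hDb | hDb
    · have hx : tiers α D D b = 1 := by simp [tiers, hDb]
      rw [hx]
      refine ⟨mem_optimalCoverages_of_isLeast (a := (1, D)) (by simp) ?_, ?_⟩
      · rintro a' (rfl | rfl)
        · rw [hloss, hloss']; exact min_le_right _ _
        · exact le_rfl
      · rintro _ ⟨a, ⟨rfl | rfl, hle⟩, rfl⟩
        · have := hle (1, D) (by simp)
          rw [hloss, hloss', min_eq_left hbp, min_eq_left hDb.le] at this
          exact absurd this hDb.not_ge
        · exact le_rfl
    -- Below the deductible both options cost `b`, and the tie is resolved towards no coverage.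
    · have hx : tiers α D D b = 0 := by simp [tiers, hDb.not_gt]
      rw [hx]
      refine ⟨mem_optimalCoverages_of_isLeast (a := (0, 0)) (by simp) ?_, ?_⟩
      · rintro a' (rfl | rfl)
        · exact le_rfl
        · rw [hloss, hloss', min_eq_left hbp, min_eq_right hDb]
      · rintro _ ⟨a, ⟨rfl | rfl, -⟩, rfl⟩
        · exact le_rfl
        · exact zero_le_one
  · simp [tiers, hD.trans_lt hbp]
  · refine mem_optimalCoverages_of_isLeast (a := (1, D)) (by simp) ?_
    rintro a' (rfl | rfl)
    · rw [hloss, hloss']; exact min_le_right _ _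
    · exact le_rfl

/-- Out-of-pocket maxima at `α * D₁ + (1 - α) * D₂` make `D₂` the valuation that is indifferent
between the coverages `α` and `1`. -/
theorem induces_limited {α D₁ D₂ : ℝ} (hα : α ∈ Ioo (0 : ℝ) 1) (h12 : D₁ < D₂)
    (h2 : D₂ ≤ p) :
    E.Induces p {(α, D₁), (1, α * D₁ + (1 - α) * D₂)} (tiers α D₁ D₂) := by
  set M := α * D₁ + (1 - α) * D₂ with hM
  have hα0 := hα.1
  have hα1 : 0 < 1 - α := sub_pos.2 hα.2
  have hloss : ∀ b, itemLoss p b (0, 0) = min b p := fun b => by simp [itemLoss]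
  have hlossα : ∀ b, itemLoss p b (α, D₁) = α * min D₁ (min b p) + (1 - α) * min b p :=
    fun b => rfl
  have hloss1 : ∀ b, itemLoss p b (1, M) = min M (min b p) := fun b => by simp [itemLoss]
  have hDM : D₁ < M := by nlinarith
  have hMD : M < D₂ := by nlinarith
  refine fun b hb => ⟨fun hbp => ?_, fun hbp => ⟨?_, ?_⟩⟩
  · simp only [optimalCoverages]
    rcases lt_or_ge D₂ b with hb2 | hb2
    · have hx : tiers α D₁ D₂ b = 1 := by simp [tiers, hb2]
      have e0 : itemLoss p b (0, 0) = b := by rw [hloss, min_eq_left hbp]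
      have eα : itemLoss p b (α, D₁) = α * D₁ + (1 - α) * b := by
        rw [hlossα, min_eq_left hbp, min_eq_left (h12.trans hb2).le]
      have e1 : itemLoss p b (1, M) = M := by
        rw [hloss1, min_eq_left hbp, min_eq_left (hMD.trans hb2).le]
      -- Above `D₂` the maximum is strictly cheaper, because equality holds at `b = D₂`.
      have hlt : M < α * D₁ + (1 - α) * b := by nlinarith
      rw [hx]
      refine ⟨mem_optimalCoverages_of_isLeast (a := (1, M)) (by simp) ?_, ?_⟩
      · rintro a' (rfl | rfl | rfl)
        · rw [e0, e1]; exact (hMD.trans hb2).le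
        · rw [eα, e1]; exact hlt.le
        · exact le_rfl
      · rintro _ ⟨a, ⟨rfl | rfl | rfl, hle⟩, rfl⟩
        · have := hle (1, M) (by simp)
          rw [e0, e1] at this
          exact absurd this (hMD.trans hb2).not_ge
        · have := hle (1, M) (by simp)
          rw [eα, e1] at this
          exact absurd this hlt.not_ge
        · exact le_rfl
    -- At `b = D₂` coverages `α` and `1` tie, and the smaller one is taken, as in `tiers`.
    · rcases lt_or_ge D₁ b with hb1 | hb1
      · have hx : tiers α D₁ D₂ b = α := by simp [tiers, hb2.not_gt, hb1]
        have e0 : itemLoss p b (0, 0) = b := by rw [hloss, min_eq_left hbp]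
        have eα : itemLoss p b (α, D₁) = α * D₁ + (1 - α) * b := by
          rw [hlossα, min_eq_left hbp, min_eq_left hb1.le]
        have e1 : itemLoss p b (1, M) = min M b := by rw [hloss1, min_eq_left hbp]
        have hlt : α * D₁ + (1 - α) * b < b := by nlinarith
        rw [hx]
        refine ⟨mem_optimalCoverages_of_isLeast (a := (α, D₁)) (by simp) ?_, ?_⟩
        · rintro a' (rfl | rfl | rfl)
          · rw [e0, eα]; exact hlt.le
          · exact le_rfl
          · rw [e1, eα]; exact le_min (by nlinarith) hlt.le
        · rintro _ ⟨a, ⟨rfl | rfl | rfl, hle⟩, rfl⟩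
          · have := hle (α, D₁) (by simp)
            rw [e0, eα] at this
            exact absurd this hlt.not_ge
          · exact le_rfl
          · exact hα.2.le
      -- Up to `D₁` all three options cost `b`, so the smallest coverage is `0`.
      · have hx : tiers α D₁ D₂ b = 0 := by simp [tiers, hb2.not_gt, hb1.not_gt]
        have e0 : itemLoss p b (0, 0) = b := by rw [hloss, min_eq_left hbp]
        have eα : itemLoss p b (α, D₁) = b := by
          rw [hlossα, min_eq_left hbp, min_eq_right hb1]; ring
        have e1 : itemLoss p b (1, M) = b := by
          rw [hloss1, min_eq_left hbp, min_eq_right (hb1.trans hDM.le)]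
        rw [hx]
        refine ⟨mem_optimalCoverages_of_isLeast (a := (0, 0)) (by simp) ?_, ?_⟩
        · rintro a' (rfl | rfl | rfl)
          · exact le_rfl
          · rw [e0, eα]
          · rw [e0, e1]
        · rintro _ ⟨a, ⟨rfl | rfl | rfl, -⟩, rfl⟩
          · exact le_rfl
          · exact hα0.le
          · exact zero_le_one
  · simp [tiers, h2.trans_lt hbp]
  · refine mem_optimalCoverages_of_isLeast (a := (1, M)) (by simp) ?_
    have e1 : itemLoss p b (1, M) = M := by
      rw [hloss1, min_eq_right hbp.le, min_eq_left (hMD.le.trans h2)]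
    rintro a' (rfl | rfl | rfl)
    · rw [hloss, e1, min_eq_right hbp.le]; exact hMD.le.trans h2
    · rw [hlossα, e1, min_eq_right hbp.le, min_eq_left (h12.le.trans h2), hM]
      nlinarith
    · exact le_rfl

end InsuranceModel

end

/-! ### The theorem -/

theorem theorem1 (E : InsuranceModel) (pN pF p : ℝ)
    (hN : E.IsNoCoveragePrice pN) (hF : E.IsFullCoveragePrice pF)
    (hp : p ∈ Set.Icc pN pF) :
    ∃ (x : ℝ → ℝ → ℝ) (α : ℝ), α ∈ Set.Ioo (0 : ℝ) 1 ∧ E.IsSolution p x ∧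
      ∀ θ ∈ E.Θ,
        (∃ D ∈ Set.Icc (0 : ℝ) p, E.Induces p {(1, D)} (x θ)) ∨
        (∃ D M : ℝ, 0 ≤ D ∧ D < M ∧ M ≤ p ∧ E.Induces p {(α, D), (1, M)} (x θ)) := by
  have hp0 : 0 < p := hN.1.trans_le hp.1
  obtain ⟨c, hc0, hcp, hc, hor⟩ := E.exists_truncation hp0
  obtain ⟨α, D₁, D₂, hα, hD₁, hD₂, hD, hval, hopt⟩ :=
    exists_optimal_tiers (μ := volume.restrict E.Θ) (R := E.RS p) hc0
      (InsuranceModel.integrable_J_mul_h_mul_f p hc0.le hc)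
      (InsuranceModel.integrable_h_mul_f hc0.le hc)
      (by
        filter_upwards [InsuranceModel.ae_lebesgue] with z hz
        exact mul_pos (InsuranceModel.h_pos hz.1 hc hz.2) (E.f_pos _ hz.1))
      (InsuranceModel.RS_nonneg hN hp.1)
      ((InsuranceModel.RS_le hF hp0.le hp.2).trans_eq
        (InsuranceModel.integral_h_mul_f hc0 hc hcp hor).symm)
  have hx := isMonotoneAllocation_tiers (volume.restrict E.Θ) c hα hD₁ hD₂
  refine ⟨fun θ => tiers α (D₁ θ) (D₂ θ), α, hα, ⟨⟨(measurable_tiers hD₁ hD₂).aemeasurable,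
    fun _ _ b _ => tiers_mem_Icc hα _ _ b, fun _ _ => (tiers_monotone hα _ _).monotoneOn _, ?_⟩,
    fun y hy => ?_⟩, fun θ _ => ?_⟩
  · exact (InsuranceModel.coveredDemand_eq hc0 hc hcp hor hx).trans hval
  · have hy' := InsuranceModel.isMonotoneAllocation_of_isFeasible hc hy
    rw [InsuranceModel.profit_eq hc0 hc hcp hor hy', InsuranceModel.profit_eq hc0 hc hcp hor hx]
    refine add_le_add_left ?_ _
    exact hopt y hy' ((InsuranceModel.coveredDemand_eq hc0 hc hcp hor hy').symm.trans hy.eq)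
  · obtain ⟨h0, h12, h2⟩ := hD θ
    -- Coinciding thresholds leave no partial tier and give a simple deductible; distinct ones give
    -- a maximum strictly above `D₁` and below `D₂ ≤ p`.
    rcases h12.eq_or_lt with heq | hlt
    · refine Or.inl ⟨D₁ θ, ⟨h0, h12.trans (h2.trans hcp)⟩, ?_⟩
      simp only [← heq]
      exact InsuranceModel.induces_simple (h12.trans (h2.trans hcp))
    · refine Or.inr ⟨D₁ θ, α * D₁ θ + (1 - α) * D₂ θ, h0, ?_, ?_,
        InsuranceModel.induces_limited hα hlt (h2.trans hcp)⟩
      · nlinarith [hα.1, hα.2]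
      · nlinarith [hα.1, hα.2, h2.trans hcp]
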